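/- Let $H$ be a connected finite-dimensional Lie group with Lie algebra $\mathfrak h$, let $(P,\omega_P)$ be a connected finite-dimensional symplectic manifold on which $H$ acts smoothly by symplectic maps, and let $H$ act on $H\times P$ by $g\cdot(h,x)=(gh,g\cdot x)$, with infinitesimal generators $\xi_{H\times P}$, $\xi\in\mathfrak h$. Let $B$ be a closed two-form on $H\times P$ with $B|_P=-\omega_P$ that has a $B\mathfrak g$-potential, i.e. a smooth map $\phi:H\times P\to\mathfrak h^*$ with $\mathbf i_{\xi_{H\times P}}B=\mathbf d\langle\phi,\xi\rangle$ for all $\xi\in\mathfrak h$, and let $$\Sigma(\xi,\eta)=-\langle\phi,[\xi,\eta]\rangle+B(\xi_{H\times P},\eta_{H\times P})\in C^\infty(H\times P)$$ be its non-equivariance two-cocycle. On $\mathfrak h^*\times P$ consider the bracket $$\{f,k\}_\Sigma=\{f|_{\mathfrak h^*},k|_{\mathfrak h^*}\}_{\mathrm{l.p.}}-\{f|_P,k|_P\}_P-\Sigma\Big(\frac{\delta f}{\delta\mu},\frac{\delta k}{\delta\mu}\Big),$$ where $\{f,k\}_{\mathrm{l.p.}}(\mu)=-\langle\mu,[\frac{\delta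 f}{\delta\mu},\frac{\delta k}{\delta\mu}]\rangle$ is the Lie–Poisson bracket, $\{\cdot,\cdot\}_P$ is the Poisson bracket of $\omega_P$, and $\Sigma$ is evaluated at $(e,x)$. The symplectic leaf through a point is the set of all points that can be reached from it along a piecewise smooth curve each piece of which is a trajectory of a locally defined Hamiltonian vector field. If $\Sigma=0$, then the symplectic leaf of $\{\cdot,\cdot\}_{\Sigma=0}$ through $(\mu,x)$ is $\mathcal O_\mu\times P$, where $\mathcal O_\mu$ is the coadjoint orbit of $\mu$ under $H$; thus the symplectic leaves are exactly the products $\mathcal O_\mu\times P$, $\mu\in\mathfrak h^*$. For $H=\operatorname{SE}(2)$, with coordinates $(\Pi_x,\Pi_y,\Omega)$ on $\mathfrak{se}(2)^*\cong\mathbb R^3$ dual to the infinitesimal translations $\mathbf e_x,\mathbf e_y$ and the infinitesimal rotation $\mathbf e_\Omega$, the coadjoint orbits are exactly the cylinders $\{\Pi_x^2+\Pi_y^2=r\}$ with $r>0$ and the single points $(0,0,c)$, $c\in\mathbb R$, of the $\Omega$-axis. For $P=\mathbb R^{2N}$, $N\ge 0$, with $\omega_P=\sum_{i=1}^N\Gamma_i\,dx_i\wedge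 dy_i$ and arbitrary nonzero real vortex strengths $\Gamma_i$, the symplectic leaves of $\{\cdot,\cdot\}_{\Sigma=0}$ on $\mathfrak{se}(2)^*\times\mathbb R^{2N}$ are exactly the products of these cylinders and of these points with $\mathbb R^{2N}$. -/

import Mathlib

open Set
open scoped Manifold ContDiff

noncomputable section

namespace SymplecticLeaves

/-! ### Two-forms and symplectic forms on a manifold -/

section TwoForms

variable {E : Type*} [NormedAddCommGroup E] [NormedSpace ℝ E]
  {A : Type*} [TopologicalSpace A] (I : ModelWithCorners ℝ E A)
  (M : Type*) [TopologicalSpace M] [ChartedSpace A M] [IsManifold I ∞ M]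

/-- A smooth differential two-form on `M`. -/
structure TwoForm where
  toFun : ∀ x : M, TangentSpace I x →L[ℝ] TangentSpace I x →L[ℝ] ℝ
  alternating : ∀ (x : M) (v : TangentSpace I x), toFun x v v = 0
  smooth : ContMDiff I (I.prod 𝓘(ℝ, E →L[ℝ] E →L[ℝ] ℝ)) ∞
    (fun x : M => Bundle.TotalSpace.mk' (E →L[ℝ] E →L[ℝ] ℝ)
      (E := fun x : M => TangentSpace I x →L[ℝ] TangentSpace I x →L[ℝ] ℝ) x (toFun x))

variable {I M}

/-- The derivative `df(v)` of a function `f` in the direction of a tangent vector `v`. -/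
def dir (f : M → ℝ) (x : M) (v : TangentSpace I x) : ℝ := mfderiv I 𝓘(ℝ, ℝ) f x v

/-- `dΩ = 0`, where `dΩ(X, Y, Z) = X Ω(Y, Z) - Y Ω(X, Z) + Z Ω(X, Y)
- Ω([X, Y], Z) + Ω([X, Z], Y) - Ω([Y, Z], X)` for vector fields `X`, `Y`, `Z` that are smooth
near the point. -/
def TwoForm.IsClosed (Ω : TwoForm I M) : Prop :=
  ∀ (x : M) (X Y Z : ∀ y : M, TangentSpace I y),
    ContMDiffAt I I.tangent ∞ (fun y => (X y : TangentBundle I M)) x →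
    ContMDiffAt I I.tangent ∞ (fun y => (Y y : TangentBundle I M)) x →
    ContMDiffAt I I.tangent ∞ (fun y => (Z y : TangentBundle I M)) x →
    dir (fun y => Ω.toFun y (Y y) (Z y)) x (X x)
      - dir (fun y => Ω.toFun y (X y) (Z y)) x (Y x)
      + dir (fun y => Ω.toFun y (X y) (Y y)) x (Z x)
      - Ω.toFun x (VectorField.mlieBracket I X Y x) (Z x)
      + Ω.toFun x (VectorField.mlieBracket I X Z x) (Y x)
      - Ω.toFun x (VectorField.mlieBracket I Y Z x) (X x) = 0

variable (I M) in
/-- A symplectic form: a smooth, closed, nondegenerate two-form. -/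
structure SymplecticForm extends TwoForm I M where
  closed : toTwoForm.IsClosed
  nondegenerate : ∀ (x : M) (v : TangentSpace I x), (∀ w, toFun x v w = 0) → v = 0

variable [FiniteDimensional ℝ E]

/-- The isomorphism `T_x M ≃ T_x^* M`, `v ↦ Ω(v, ·)`. -/
def SymplecticForm.flat (Ω : SymplecticForm I M) (x : M) : E ≃ₗ[ℝ] (E →L[ℝ] ℝ) :=
  LinearMap.linearEquivOfInjective
    (V := E) (V₂ := E →L[ℝ] ℝ)
    (show E →L[ℝ] E →L[ℝ] ℝ from Ω.toFun x).toLinearMap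
    ((injective_iff_map_eq_zero _).2 fun v hv =>
      Ω.nondegenerate x v fun w => congrArg (fun α : E →L[ℝ] ℝ => α w) hv)
    (by
      rw [← (LinearMap.toContinuousLinearMap (𝕜 := ℝ) (E := E) (F' := ℝ)).finrank_eq]
      exact (Subspace.dual_finrank_eq (K := ℝ) (V := E)).symm)

/-- The vector `α^♯`, defined by `Ω(α^♯, ·) = α`. -/
def SymplecticForm.sharp (Ω : SymplecticForm I M) (x : M) (α : E →L[ℝ] ℝ) : TangentSpace I x :=
  (Ω.flat x).symm α

/-- The Poisson bracket of a symplectic manifold, `{f, k} = df((dk)^♯)`. -/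
def SymplecticForm.bracket (Ω : SymplecticForm I M) (f k : M → ℝ) (x : M) : ℝ :=
  dir f x (Ω.sharp x (mfderiv I 𝓘(ℝ, ℝ) k x))

end TwoForms

/-! ### Symplectic leaves of a Poisson bracket -/

section Leaves

variable {E : Type*} [NormedAddCommGroup E] [NormedSpace ℝ E]
  {A : Type*} [TopologicalSpace A] (I : ModelWithCorners ℝ E A)
  {M : Type*} [TopologicalSpace M] [ChartedSpace A M]

/-- `X` is on `U` the Hamiltonian vector field of `f` for the bracket `br`: `X(F) = {F, f}`. -/
def IsHamiltonianVectorField (br : (M → ℝ) → (M → ℝ) → M → ℝ) (f : M → ℝ) (U : Set M)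
    (X : ∀ p : M, TangentSpace I p) : Prop :=
  ∀ p ∈ U, ∀ F : M → ℝ, ContMDiffAt I 𝓘(ℝ, ℝ) ∞ F p →
    dir F p (X p) = br F f p

/-- `p` is joined to `q` by a trajectory of a locally defined Hamiltonian vector field. -/
def HamiltonianSegment (br : (M → ℝ) → (M → ℝ) → M → ℝ) (p q : M) : Prop :=
  ∃ (U : Set M) (f : M → ℝ) (X : ∀ p : M, TangentSpace I p) (γ : ℝ → M) (a b : ℝ),
    IsOpen U ∧ ContMDiffOn I 𝓘(ℝ, ℝ) ∞ f U ∧ IsHamiltonianVectorField I br f U X ∧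
    a ≤ b ∧ MapsTo γ (Icc a b) U ∧ IsMIntegralCurveOn γ X (Icc a b) ∧ γ a = p ∧ γ b = q

/-- The symplectic leaf through `p`: all points that can be reached from `p` along a piecewise
smooth curve, each piece of which is a trajectory of a locally defined Hamiltonian vector field. -/
def symplecticLeaf (br : (M → ℝ) → (M → ℝ) → M → ℝ) (p : M) : Set M :=
  {q | Relation.ReflTransGen (HamiltonianSegment I br) p q}

/-- The collection of all symplectic leaves. -/
def symplecticLeaves (br : (M → ℝ) → (M → ℝ) → M → ℝ) : Set (Set M) :=
  range (symplecticLeaf I br)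

end Leaves

/-! ### The dual of the Lie algebra of a Lie group

The Lie algebra `𝔥` is the tangent space at the identity, which Mathlib models on the vector
space `E`, with the bracket of left-invariant vector fields; its dual `𝔥*` is `E →L[ℝ] ℝ`. -/

section LieDual

variable {E : Type*} [NormedAddCommGroup E] [NormedSpace ℝ E]
  {A : Type*} [TopologicalSpace A] (I : ModelWithCorners ℝ E A)
  (H : Type*) [TopologicalSpace H] [ChartedSpace A H] [Group H]

/-- The Lie bracket of `𝔥`. -/
def lieBr (ξ η : E) : E :=
  Bracket.bracket (L := GroupLieAlgebra I H) (M := GroupLieAlgebra I H) ξ η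

variable {H}

/-- The adjoint action: `Ad_g` is the derivative at the identity of `h ↦ g h g⁻¹`. -/
def Ad (g : H) : E →L[ℝ] E := mfderiv I I (fun h : H => g * h * g⁻¹) 1

variable (H) in
/-- The coadjoint orbit `O_μ = {Ad_{g⁻¹}^* μ | g ∈ H}`. -/
def coadjointOrbit (μ : E →L[ℝ] ℝ) : Set (E →L[ℝ] ℝ) :=
  {ν | ∃ g : H, ν = μ.comp (Ad I g⁻¹)}

variable [FiniteDimensional ℝ E]

variable (E) in
/-- The canonical isomorphism `𝔥 ≃ 𝔥**`. -/
def bidual : E ≃ₗ[ℝ] ((E →L[ℝ] ℝ) →L[ℝ] ℝ) :=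
  LinearMap.linearEquivOfInjective (NormedSpace.inclusionInDoubleDual ℝ E).toLinearMap
    (NormedSpace.inclusionInDoubleDualLi ℝ (E := E)).injective
    (by
      rw [← (LinearMap.toContinuousLinearMap (𝕜 := ℝ) (E := E →L[ℝ] ℝ) (F' := ℝ)).finrank_eq,
        Subspace.dual_finrank_eq,
        ← (LinearMap.toContinuousLinearMap (𝕜 := ℝ) (E := E) (F' := ℝ)).finrank_eq,
        Subspace.dual_finrank_eq])

/-- The functional derivative `δf/δμ ∈ 𝔥`, defined by `Df(μ)(ν) = ⟨ν, δf/δμ⟩`. -/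
def funcDeriv (f : (E →L[ℝ] ℝ) → ℝ) (μ : E →L[ℝ] ℝ) : E :=
  (bidual E).symm (fderiv ℝ f μ)

variable (H) in
/-- The (minus) Lie-Poisson bracket `{f, k}(μ) = -⟨μ, [δf/δμ, δk/δμ]⟩` on `𝔥*`. -/
def liePoisson (f k : (E →L[ℝ] ℝ) → ℝ) (μ : E →L[ℝ] ℝ) : ℝ :=
  -μ (lieBr I H (funcDeriv f μ) (funcDeriv k μ))

end LieDual

/-! ### Coupling of a Lie group to a symplectic manifold -/

section Coupling

variable {E : Type*} [NormedAddCommGroup E] [NormedSpace ℝ E]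
  {A : Type*} [TopologicalSpace A] {I : ModelWithCorners ℝ E A}
  {H : Type*} [TopologicalSpace H] [ChartedSpace A H] [Group H]
  {F : Type*} [NormedAddCommGroup F] [NormedSpace ℝ F]
  {C : Type*} [TopologicalSpace C] {J : ModelWithCorners ℝ F C}
  {P : Type*} [TopologicalSpace P] [ChartedSpace C P]

variable (I J) in
/-- The infinitesimal generator `ξ_{H × P}` of the diagonal action `g · (h, x) = (g h, g x)`. -/
def generator [MulAction H P] (ξ : E) (p : H × P) : TangentSpace (I.prod J) p :=
  mfderiv I (I.prod J) (fun g : H => (g * p.1, g • p.2)) 1 ξ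

variable (H) in
/-- The data that couple `H` to the symplectic manifold `(P, Ω)`, on which `H` acts by
symplectic maps: a closed two-form `B` on `H × P` with `B|_P = -Ω`, and a `B𝔤`-potential
`φ : H × P → 𝔥*`, that is `i_{ξ_{H × P}} B = d⟨φ, ξ⟩` for all `ξ ∈ 𝔥`. -/
structure MagneticCoupling [LieGroup I ∞ H] [IsManifold J ∞ P] [MulAction H P]
    (Ω : SymplecticForm J P) where
  action_symplectic : ∀ (g : H) (x : P) (v w : TangentSpace J x),
    Ω.toFun (g • x) (mfderiv J J (fun y : P => g • y) x v) (mfderiv J J (fun y : P => g • y) x w)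
      = Ω.toFun x v w
  B : TwoForm (I.prod J) (H × P)
  B_closed : B.IsClosed
  B_restrict : ∀ (h : H) (x : P) (v w : F),
    B.toFun (h, x) ((0, v) : E × F) ((0, w) : E × F) = -Ω.toFun x v w
  φ : H × P → (E →L[ℝ] ℝ)
  φ_smooth : ContMDiff (I.prod J) 𝓘(ℝ, E →L[ℝ] ℝ) ∞ φ
  φ_potential : ∀ (ξ : E) (p : H × P) (v : TangentSpace (I.prod J) p),
    B.toFun p (generator I J ξ p) v = dir (fun q => φ q ξ) p v

/-- The non-equivariance two-cocycle
`Σ(ξ, η) = -⟨φ, [ξ, η]⟩ + B(ξ_{H × P}, η_{H × P})`, with values in functions on `H × P`. -/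
def MagneticCoupling.cocycle [LieGroup I ∞ H] [IsManifold J ∞ P] [MulAction H P]
    {Ω : SymplecticForm J P} (D : MagneticCoupling (I := I) H Ω) (ξ η : E) (p : H × P) : ℝ :=
  -D.φ p (lieBr I H ξ η) + D.B.toFun p (generator I J ξ p) (generator I J η p)

variable (I H) in
/-- The natural bracket
`{f, k}_Σ = {f|_{𝔥*}, k|_{𝔥*}}_{l.p.} - {f|_P, k|_P}_P - Σ(δf/δμ, δk/δμ)` on `𝔥* × P`, where the
values of `Σ` are regarded as functions on `P` by restriction to `{e} × P`. -/
def naturalBracket [FiniteDimensional ℝ E] [FiniteDimensional ℝ F] [IsManifold J ∞ P]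
    (Ω : SymplecticForm J P) (S : E → E → H × P → ℝ)
    (f k : (E →L[ℝ] ℝ) × P → ℝ) (z : (E →L[ℝ] ℝ) × P) : ℝ :=
  liePoisson I H (fun μ => f (μ, z.2)) (fun μ => k (μ, z.2)) z.1
    - Ω.bracket (fun x => f (z.1, x)) (fun x => k (z.1, x)) z.2
    - S (funcDeriv (fun μ => f (μ, z.2)) z.1) (funcDeriv (fun μ => k (μ, z.2)) z.1) (1, z.2)

end Coupling

/-! ### The Euclidean group of the plane -/

section Euclidean

/-- The group `SE(2)` of pairs `(R, x₀)` of a rotation and a translation of the plane `ℝ² = ℂ`,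
with `(R, x₀) (R', x₀') = (R R', R x₀' + x₀)`. -/
def SE2 : Type := Circle × ℂ

namespace SE2

instance : TopologicalSpace SE2 := inferInstanceAs (TopologicalSpace (Circle × ℂ))

instance : ChartedSpace (ModelProd (EuclideanSpace ℝ (Fin 1)) ℂ) SE2 :=
  inferInstanceAs (ChartedSpace (ModelProd (EuclideanSpace ℝ (Fin 1)) ℂ) (Circle × ℂ))

/-- The model space of `SE(2)`, and so the vector space that underlies `𝔰𝔢(2)`. -/
abbrev Model : Type := EuclideanSpace ℝ (Fin 1) × ℂ

/-- The model with corners of `SE(2)`, as the product manifold `S¹ × ℝ²`. -/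
abbrev 𝓘SE : ModelWithCorners ℝ Model (ModelProd (EuclideanSpace ℝ (Fin 1)) ℂ) :=
  (𝓡 1).prod 𝓘(ℝ, ℂ)

instance : Group SE2 where
  mul g h := (g.1 * h.1, (g.1 : ℂ) * h.2 + g.2)
  one := (1, 0)
  inv g := (g.1⁻¹, -(((g.1⁻¹ : Circle) : ℂ) * g.2))
  mul_assoc a b c := Prod.ext (mul_assoc _ _ _) (by
    change ((a.1 * b.1 : Circle) : ℂ) * c.2 + (a.1 * b.2 + a.2)
      = a.1 * (b.1 * c.2 + b.2) + a.2
    push_cast; ring)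
  one_mul a := Prod.ext (one_mul _) (by
    change ((1 : Circle) : ℂ) * a.2 + 0 = a.2
    simp)
  mul_one a := Prod.ext (mul_one _) (by
    change (a.1 : ℂ) * 0 + a.2 = a.2
    simp)
  inv_mul_cancel a := Prod.ext (inv_mul_cancel _) (by
    change ((a.1⁻¹ : Circle) : ℂ) * a.2 + -(((a.1⁻¹ : Circle) : ℂ) * a.2) = 0
    simp)

theorem contMDiff_coe : ContMDiff (𝓡 1) 𝓘(ℝ, ℂ) ∞ (fun z : Circle => (z : ℂ)) :=
  haveI : Fact (Module.finrank ℝ ℂ = 1 + 1) := finrank_real_complex_fact'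
  contMDiff_coe_sphere

theorem contMDiff_cmul {G : Type*} [NormedAddCommGroup G] [NormedSpace ℝ G]
    {K : Type*} [TopologicalSpace K] {I : ModelWithCorners ℝ G K}
    {M : Type*} [TopologicalSpace M] [ChartedSpace K M] {f g : M → ℂ}
    (hf : ContMDiff I 𝓘(ℝ, ℂ) ∞ f) (hg : ContMDiff I 𝓘(ℝ, ℂ) ∞ g) :
    ContMDiff I 𝓘(ℝ, ℂ) ∞ (fun x => f x * g x) :=
  ((ContinuousLinearMap.mul ℝ ℂ).contMDiff.comp hf).clm_apply hg

instance : LieGroup 𝓘SE ∞ SE2 where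
  toIsManifold := inferInstanceAs (IsManifold 𝓘SE ∞ (Circle × ℂ))
  contMDiff_mul := by
    have h : ContMDiff (𝓘SE.prod 𝓘SE) 𝓘SE ∞
        (fun p : (Circle × ℂ) × (Circle × ℂ) =>
          ((p.1.1 * p.2.1, (p.1.1 : ℂ) * p.2.2 + p.1.2) : Circle × ℂ)) := by
      have a : ContMDiff (𝓘SE.prod 𝓘SE) (𝓡 1) ∞
          (fun p : (Circle × ℂ) × (Circle × ℂ) => p.1.1) := contMDiff_fst.comp contMDiff_fst
      have b : ContMDiff (𝓘SE.prod 𝓘SE) (𝓡 1) ∞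
          (fun p : (Circle × ℂ) × (Circle × ℂ) => p.2.1) := contMDiff_fst.comp contMDiff_snd
      have c : ContMDiff (𝓘SE.prod 𝓘SE) 𝓘(ℝ, ℂ) ∞
          (fun p : (Circle × ℂ) × (Circle × ℂ) => p.1.2) := contMDiff_snd.comp contMDiff_fst
      have d : ContMDiff (𝓘SE.prod 𝓘SE) 𝓘(ℝ, ℂ) ∞
          (fun p : (Circle × ℂ) × (Circle × ℂ) => p.2.2) := contMDiff_snd.comp contMDiff_snd
      exact (a.mul b).prodMk ((contMDiff_cmul (contMDiff_coe.comp a) d).add c)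
    exact h
  contMDiff_inv := by
    have h : ContMDiff 𝓘SE 𝓘SE ∞
        (fun p : Circle × ℂ => ((p.1⁻¹, -(((p.1⁻¹ : Circle) : ℂ) * p.2)) : Circle × ℂ)) := by
      have a : ContMDiff 𝓘SE (𝓡 1) ∞ (fun p : Circle × ℂ => p.1⁻¹) := contMDiff_fst.inv
      exact a.prodMk (contMDiff_cmul (contMDiff_coe.comp a) contMDiff_snd).neg
    exact h

/-- `e_Ω`, the velocity at `t = 0` of the rotations `t ↦ (e^{it}, 0)`. -/
def eΩ : Model := mfderiv 𝓘(ℝ, ℝ) 𝓘SE (fun t : ℝ => ((Circle.exp t, 0) : SE2)) 0 (1 : ℝ)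

/-- `e_x`, the velocity at `t = 0` of the translations `t ↦ (1, t)`. -/
def ex : Model := mfderiv 𝓘(ℝ, ℝ) 𝓘SE (fun t : ℝ => ((1, (t : ℂ)) : SE2)) 0 (1 : ℝ)

/-- `e_y`, the velocity at `t = 0` of the translations `t ↦ (1, it)`. -/
def ey : Model := mfderiv 𝓘(ℝ, ℝ) 𝓘SE (fun t : ℝ => ((1, (t : ℂ) * Complex.I) : SE2)) 0 (1 : ℝ)

/-- For a constant `r`, the cylinder `Π_x² + Π_y² = r` in `𝔰𝔢(2)*`, where
`(Π_x, Π_y, Π_Ω) = (⟨Π, e_x⟩, ⟨Π, e_y⟩, ⟨Π, e_Ω⟩)`. -/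
def cylinder (r : ℝ) : Set (Model →L[ℝ] ℝ) := {ν | ν ex ^ 2 + ν ey ^ 2 = r}

/-- The point `(0, 0, c)` of the `Ω`-axis, as a subset of `𝔰𝔢(2)*`. -/
def axisPoint (c : ℝ) : Set (Model →L[ℝ] ℝ) := {ν | ν ex = 0 ∧ ν ey = 0 ∧ ν eΩ = c}

end SE2

end Euclidean

/-! ### Constant two-forms on a vector space -/

section ConstForm

variable {V : Type*} [NormedAddCommGroup V] [NormedSpace ℝ V]

/-- A bilinear form on `V`, regarded as a bilinear form on each tangent space of `V`. -/
def constSection (b : V →L[ℝ] V →L[ℝ] ℝ) (x : V) :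
    TangentSpace 𝓘(ℝ, V) x →L[ℝ] TangentSpace 𝓘(ℝ, V) x →L[ℝ] ℝ := b

/-- An alternating bilinear form on a vector space, as a two-form with constant coefficients. -/
def constForm (b : V →L[ℝ] V →L[ℝ] ℝ) (hb : ∀ v, b v v = 0) : TwoForm 𝓘(ℝ, V) V where
  toFun := constSection b
  alternating _ v := hb v
  smooth := by
    intro x
    rw [Bundle.contMDiffAt_section]
    convert! contMDiffAt_const (c := b)
    ext v w
    rw [hom_trivializationAt_apply]
    simp only [ContinuousLinearMap.inCoordinates]
    simp
    rw [Bundle.Trivialization.linearMapAt_apply,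
      if_pos (by simp only [hom_trivializationAt_baseSet]; simp [chartAt_self_eq]),
      hom_trivializationAt_apply]
    simp [ContinuousLinearMap.inCoordinates]
    rfl

theorem constForm_isClosed (b : V →L[ℝ] V →L[ℝ] ℝ) (hb : ∀ v, b v v = 0) :
    (constForm b hb).IsClosed := by
  intro x X Y Z hX hY hZ
  have hX' : DifferentiableAt ℝ (show V → V from X) x :=
    (contMDiffAt_vectorSpace_iff_contDiffAt.1 hX).differentiableAt (by simp)
  have hY' : DifferentiableAt ℝ (show V → V from Y) x :=
    (contMDiffAt_vectorSpace_iff_contDiffAt.1 hY).differentiableAt (by simp)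
  have hZ' : DifferentiableAt ℝ (show V → V from Z) x :=
    (contMDiffAt_vectorSpace_iff_contDiffAt.1 hZ).differentiableAt (by simp)
  have key : ∀ (S T : V → V) (u : V), DifferentiableAt ℝ S x → DifferentiableAt ℝ T x →
      fderiv ℝ (fun y => b (S y) (T y)) x u
        = b (fderiv ℝ S x u) (T x) + b (S x) (fderiv ℝ T x u) := by
    intro S T u hS hT
    have := (b.hasFDerivAt.comp x hS.hasFDerivAt).clm_apply hT.hasFDerivAt
    have h2 := this.fderiv
    change fderiv ℝ (fun y => b (S y) (T y)) x = _ at h2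
    rw [h2]
    simp [add_comm]
  have hsymm : ∀ v w, b v w = - b w v := by
    intro v w
    have h := hb (v + w)
    simp only [map_add, add_apply, hb] at h
    linarith
  have dirEq : ∀ (f : V → ℝ) (u : V), dir (I := 𝓘(ℝ, V)) f x u = fderiv ℝ f x u := by
    intro f u
    simp only [dir, mfderiv_eq_fderiv]
    rfl
  have brEq : ∀ S T : V → V, VectorField.mlieBracket 𝓘(ℝ, V) (M := V) S T x
      = fderiv ℝ T x (S x) - fderiv ℝ S x (T x) := by
    intro S T
    have h1 := congrFun (VectorField.mlieBracketWithin_eq_lieBracketWithin (𝕜 := ℝ)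
      (V := S) (W := T) (s := univ)) x
    have h2 := congrFun (VectorField.lieBracketWithin_univ (𝕜 := ℝ) (V := S) (W := T)) x
    exact h1.trans h2
  have main : ∀ S T R : V → V, DifferentiableAt ℝ S x → DifferentiableAt ℝ T x →
      DifferentiableAt ℝ R x →
      fderiv ℝ (fun y => b (T y) (R y)) x (S x) - fderiv ℝ (fun y => b (S y) (R y)) x (T x)
      + fderiv ℝ (fun y => b (S y) (T y)) x (R x)
      - b (fderiv ℝ T x (S x) - fderiv ℝ S x (T x)) (R x)
      + b (fderiv ℝ R x (S x) - fderiv ℝ S x (R x)) (T x)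
      - b (fderiv ℝ R x (T x) - fderiv ℝ T x (R x)) (S x) = 0 := by
    intro S T R hS hT hR
    rw [key T R _ hT hR, key S R _ hS hR, key S T _ hS hT]
    simp only [map_sub, sub_apply]
    rw [hsymm (T x), hsymm (S x) (fderiv ℝ R x (T x)), hsymm (S x) (fderiv ℝ T x (R x))]
    ring
  have h := main X Y Z hX' hY' hZ'
  have e1 := brEq X Y
  have e2 := brEq X Z
  have e3 := brEq Y Z
  have d1 := dirEq (fun y => b (Y y) (Z y)) (X x)
  have d2 := dirEq (fun y => b (X y) (Z y)) (Y x)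
  have d3 := dirEq (fun y => b (X y) (Y y)) (Z x)
  refine Eq.trans ?_ h
  exact congrArg₂ (· - ·) (congrArg₂ (· + ·) (congrArg₂ (· - ·) (congrArg₂ (· + ·)
    (congrArg₂ (· - ·) d1 d2) d3) (congrArg (fun u => b u (Z x)) e1))
    (congrArg (fun u => b u (Y x)) e2)) (congrArg (fun u => b u (X x)) e3)

end ConstForm

/-! ### The symplectic form of `N` point vortices -/

section Vortices

variable {N : ℕ}

/-- The bilinear form `∑ᵢ Γᵢ (dxᵢ ∧ dyᵢ)(v, w)` on `ℝ^{2N} = ℂ^N`. -/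
def vortexBilin (Γ : Fin N → ℝ) : (Fin N → ℂ) →L[ℝ] (Fin N → ℂ) →L[ℝ] ℝ :=
  LinearMap.toContinuousLinearMap
    ((LinearMap.toContinuousLinearMap
      (𝕜 := ℝ) (E := Fin N → ℂ) (F' := ℝ)).toLinearMap ∘ₗ
    LinearMap.mk₂ ℝ (fun v w : Fin N → ℂ =>
      ∑ i, Γ i * ((v i).re * (w i).im - (w i).re * (v i).im))
      (fun v v' w => by
        rw [← Finset.sum_add_distrib]
        exact Finset.sum_congr rfl fun i _ => by simp; ring)
      (fun c v w => by
        rw [smul_eq_mul, Finset.mul_sum]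
        exact Finset.sum_congr rfl fun i _ => by simp; ring)
      (fun v w w' => by
        rw [← Finset.sum_add_distrib]
        exact Finset.sum_congr rfl fun i _ => by simp; ring)
      (fun c v w => by
        rw [smul_eq_mul, Finset.mul_sum]
        exact Finset.sum_congr rfl fun i _ => by simp; ring))

theorem vortexBilin_apply (Γ : Fin N → ℝ) (v w : Fin N → ℂ) :
    vortexBilin Γ v w = ∑ i, Γ i * ((v i).re * (w i).im - (w i).re * (v i).im) := rfl

theorem vortexBilin_self (Γ : Fin N → ℝ) (v : Fin N → ℂ) : vortexBilin Γ v v = 0 := by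
  rw [vortexBilin_apply]
  exact Finset.sum_eq_zero fun i _ => by ring

theorem vortexBilin_nondegenerate {Γ : Fin N → ℝ} (hΓ : ∀ i, Γ i ≠ 0) (v : Fin N → ℂ)
    (h : ∀ w, vortexBilin Γ v w = 0) : v = 0 := by
  funext i
  have h1 := h (Pi.single i Complex.I)
  have h2 := h (Pi.single i 1)
  rw [vortexBilin_apply, Finset.sum_eq_single i (by intro j _ hj; simp [hj]) (by simp)] at h1 h2
  simp [hΓ i] at h1 h2
  exact Complex.ext h1 h2

/-- The symplectic form `∑ᵢ Γᵢ dxᵢ ∧ dyᵢ` of `N` point vortices of nonzero strengths `Γᵢ`. -/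
def vortexForm (Γ : Fin N → ℝ) (hΓ : ∀ i, Γ i ≠ 0) :
    SymplecticForm 𝓘(ℝ, Fin N → ℂ) (Fin N → ℂ) where
  toTwoForm := constForm (vortexBilin Γ) (vortexBilin_self Γ)
  closed := constForm_isClosed _ _
  nondegenerate _ v h := vortexBilin_nondegenerate hΓ v h

end Vortices

end SymplecticLeaves

end

noncomputable section

namespace SymplecticLeaves

open Filter Topology

/-! ### The adjoint representation in the chart at the identity -/

section Calculus

variable {E : Type*} [NormedAddCommGroup E] [NormedSpace ℝ E]

/-! When the cocycle vanishes, the Hamiltonian vector field of f on 𝔥* × P splits. With ξ = δf/δμ,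
its 𝔥*-component at (μ, x) is μ ∘ ad_ξ and its P-component is -(d f|_P)^♯.

Trajectories stay in O_μ × P. Along a trajectory the momentum solves the linear equation μ' = μ ∘
ad_ξ(t). If g' = g·ξ(t) with g = 1 at the initial time, then Ad_g has derivative Ad_g ∘ ad_ξ, so μ₀
∘ Ad_g(t), with μ₀ the initial momentum, solves the same equation. Uniqueness puts the trajectory in
the coadjoint orbit (`mem_coadjointOrbit_of_hasDerivWithinAt`).

Every point of O_μ × P is reached. The linear function f = ⟨·, ξ⟩ moves μ alone, along the coadjoint
action of a local one-parameter subgroup. Products of such subgroups fill a neighbourhood of 1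
(`submonoid_mem_nhds_one`), which generates the connected group H (`coadjointOrbit_induction`). A
function of x alone moves x alone, and every straight segment in a chart of P is a trajectory of
such a function (`hamiltonianSegment_chart`). As P is connected, all of P is reached with μ fixed
(`reflTransGen_snd`).

The calculus on H takes place in the chart at the identity. There ad is defined as the derivative of
Ad, and `lieBr_eq_ad` identifies it with the bracket of left-invariant fields. The equation g' =
g·ξ(t) is solved for short times only and restarted at the identity, so it never leaves this chart.

For SE(2), g = (R, x₀) acts on covectors by rotating (Π_x, Π_y) and adding to Π_Ω a linear form in
x₀ with coefficients Π_x, Π_y. This form takes every value unless Π_x = Π_y = 0, when the covector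
is fixed; hence cylinders and points. -/

/-- If `a u` intertwines the partial derivatives of a local multiplication `m` along the two axes
through `(e, e)`, then the derivative of `a` at `e` is the antisymmetrised second derivative. -/
theorem fderiv_intertwiner {m : E × E → E} {e : E} {a : E → E →L[ℝ] E}
    (hm : ContDiffAt ℝ 2 m (e, e)) (h1 : ∀ η, fderiv ℝ m (e, e) (η, 0) = η)
    (ha : DifferentiableAt ℝ a e) (hae : a e = ContinuousLinearMap.id ℝ E)
    (h : ∀ᶠ u in 𝓝 e, ∀ η, fderiv ℝ m (e, u) (a u η, 0) = fderiv ℝ m (u, e) (0, η)) (ξ η : E) :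
    fderiv ℝ a e ξ η = fderiv ℝ (fun u => fderiv ℝ m (u, e) (0, η)) e ξ
      - fderiv ℝ (fun u => fderiv ℝ m (u, e) (0, ξ)) e η := by
  have hD : HasFDerivAt (fderiv ℝ m) (fderiv ℝ (fderiv ℝ m) (e, e)) (e, e) :=
    ((hm.fderiv_right (m := 1) (by norm_num)).differentiableAt (by simp)).hasFDerivAt
  have hsym : IsSymmSndFDerivAt ℝ m (e, e) := hm.isSymmSndFDerivAt (by simp)
  have hL (η : E) : HasFDerivAt (fun u => fderiv ℝ m (u, e) ((0, η) : E × E))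
      (((ContinuousLinearMap.apply ℝ E ((0, η) : E × E)).comp
        (fderiv ℝ (fderiv ℝ m) (e, e))).comp (ContinuousLinearMap.inl ℝ E E)) e :=
    (ContinuousLinearMap.apply ℝ E ((0, η) : E × E)).hasFDerivAt.comp
      (f := fun u => fderiv ℝ m (u, e)) e
      (hD.comp (f := fun u => (u, e)) e (hasFDerivAt_prodMk_left e e))
  have hR : HasFDerivAt (fun u => fderiv ℝ m (e, u) ((a u η, 0) : E × E))
      ((fderiv ℝ m (e, e)).comp ((ContinuousLinearMap.inl ℝ E E).comp
        ((ContinuousLinearMap.apply ℝ E η).comp (fderiv ℝ a e)))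
        + ((fderiv ℝ (fderiv ℝ m) (e, e)).comp (ContinuousLinearMap.inr ℝ E E)).flip
          ((a e η, 0) : E × E)) e :=
    (hD.comp (f := fun u => (e, u)) e (hasFDerivAt_prodMk_right e e)).clm_apply
      ((ContinuousLinearMap.inl ℝ E E).hasFDerivAt.comp (f := fun u => a u η) e
        ((ContinuousLinearMap.apply ℝ E η).hasFDerivAt.comp e ha.hasFDerivAt))
  have key := (hR.congr_of_eventuallyEq (h.mono fun u hu => (hu η).symm)).unique (hL η)
  have k1 := congrArg (fun T : E →L[ℝ] E => T ξ) key
  simp [hae, h1] at k1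
  rw [(hL η).fderiv, (hL ξ).fderiv]
  -- Symmetry of the second derivative turns the term from moving the base point along the second
  -- axis into the ξ-part of the commutator.
  have k2 := hsym (η, 0) (0, ξ)
  simp
  rw [← k1, k2]
  simp

end Calculus

/-! ### Derivatives on a manifold, read in a chart -/

section Chart

variable {E : Type*} [NormedAddCommGroup E] [NormedSpace ℝ E]
  {A : Type*} [TopologicalSpace A] {I : ModelWithCorners ℝ E A} [I.Boundaryless]
  {M : Type*} [TopologicalSpace M] [ChartedSpace A M]

/-- At a fixed point one chart serves both source and target, so the manifold derivative is
literally the derivative of the coordinate expression. -/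
theorem mfderiv_eq_fderiv_chart {x : M} {f : M → M} (hf : MDifferentiableAt I I f x)
    (hx : f x = x) :
    (mfderiv I I f x : E →L[ℝ] E)
      = fderiv ℝ (fun v => extChartAt I x (f ((extChartAt I x).symm v))) (extChartAt I x x) := by
  have h : (mfderiv I I f x : E →L[ℝ] E)
      = fderivWithin ℝ (writtenInExtChartAt I I x f) (range I) (extChartAt I x x) := if_pos hf
  rw [h, ModelWithCorners.Boundaryless.range_eq_univ, fderivWithin_univ]
  simp only [writtenInExtChartAt, hx]
  rfl

theorem contMDiffAt_extChartAt_symm [IsManifold I ∞ M] {x : M} {u : E}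
    (hu : u ∈ (extChartAt I x).target) :
    ContMDiffAt 𝓘(ℝ, E) I ∞ (extChartAt I x).symm u :=
  (contMDiffOn_extChartAt_symm x).contMDiffAt ((isOpen_extChartAt_target x).mem_nhds hu)

end Chart

/-! ### Multiplication, Ad and the Lie bracket in the chart at the identity -/

section Group

set_option linter.unusedSectionVars false

variable {E : Type*} [NormedAddCommGroup E] [NormedSpace ℝ E]
  {A : Type*} [TopologicalSpace A] (I : ModelWithCorners ℝ E A)
  (H : Type*) [TopologicalSpace H] [ChartedSpace A H] [Group H]

/-- The coordinates of the identity in the chart at the identity. -/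
def chartOne : E := extChartAt I (1 : H) 1

/-- The inverse of the chart at the identity. -/
def ofChart (u : E) : H := (extChartAt I (1 : H)).symm u

/-- The multiplication of `H` in the chart at the identity. -/
def chartMul (p : E × E) : E := extChartAt I (1 : H) (ofChart I H p.1 * ofChart I H p.2)

/-- The differential at the identity of the left translation by the group element with
coordinates `u`, in the chart at the identity. -/
def chartLeft (u : E) : E →L[ℝ] E :=
  (fderiv ℝ (chartMul I H) (u, chartOne I H)).comp (ContinuousLinearMap.inr ℝ E E)

/-- The adjoint representation in the chart at the identity. -/
def chartAd (u : E) : E →L[ℝ] E := Ad I (ofChart I H u)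

/-- The adjoint representation of the Lie algebra. -/
def ad : E →L[ℝ] E →L[ℝ] E := fderiv ℝ (chartAd I H) (chartOne I H)

/-- The map `(u, v) ↦ u v u⁻¹` in the chart at the identity. -/
def chartConj (p : E × E) : E :=
  extChartAt I (1 : H) (ofChart I H p.1 * ofChart I H p.2 * (ofChart I H p.1)⁻¹)

@[simp] theorem ofChart_chartOne : ofChart I H (chartOne I H) = 1 := extChartAt_to_inv _

variable [I.Boundaryless] [LieGroup I ∞ H]

theorem contMDiffAt_ofChart : ContMDiffAt 𝓘(ℝ, E) I ∞ (ofChart I H) (chartOne I H) :=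
  have : IsManifold I ∞ H := IsManifold.of_le (m := ∞) (n := ∞) le_rfl
  contMDiffAt_extChartAt_symm (mem_extChartAt_target (1 : H))

theorem continuousAt_ofChart : ContinuousAt (ofChart I H) (chartOne I H) :=
  continuousAt_extChartAt_symm (1 : H)

theorem contMDiffAt_chart_one {g : H} (hg : g = 1) :
    ContMDiffAt I 𝓘(ℝ, E) ∞ (extChartAt I (1 : H)) g := by
  have : IsManifold I ∞ H := IsManifold.of_le (m := ∞) (n := ∞) le_rfl
  rw [hg]
  exact contMDiffAt_extChartAt

theorem contDiffAt_chartMul :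
    ContDiffAt ℝ ∞ (chartMul I H) (chartOne I H, chartOne I H) := by
  refine ContMDiffAt.contDiffAt ?_
  have h1 : ContMDiffAt 𝓘(ℝ, E × E) I ∞ (fun p : E × E => ofChart I H p.1)
      (chartOne I H, chartOne I H) :=
    ContMDiffAt.comp (f := Prod.fst) (chartOne I H, chartOne I H) (contMDiffAt_ofChart I H)
      contDiffAt_fst.contMDiffAt
  have h2 : ContMDiffAt 𝓘(ℝ, E × E) I ∞ (fun p : E × E => ofChart I H p.2)
      (chartOne I H, chartOne I H) :=
    ContMDiffAt.comp (f := Prod.snd) (chartOne I H, chartOne I H) (contMDiffAt_ofChart I H)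
      contDiffAt_snd.contMDiffAt
  exact ContMDiffAt.comp (chartOne I H, chartOne I H) (contMDiffAt_chart_one I H (by simp)) (h1.mul h2)

theorem contDiffAt_chartConj :
    ContDiffAt ℝ ∞ (chartConj I H) (chartOne I H, chartOne I H) := by
  refine ContMDiffAt.contDiffAt ?_
  have h1 : ContMDiffAt 𝓘(ℝ, E × E) I ∞ (fun p : E × E => ofChart I H p.1)
      (chartOne I H, chartOne I H) :=
    ContMDiffAt.comp (f := Prod.fst) (chartOne I H, chartOne I H) (contMDiffAt_ofChart I H)
      contDiffAt_fst.contMDiffAt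
  have h2 : ContMDiffAt 𝓘(ℝ, E × E) I ∞ (fun p : E × E => ofChart I H p.2)
      (chartOne I H, chartOne I H) :=
    ContMDiffAt.comp (f := Prod.snd) (chartOne I H, chartOne I H) (contMDiffAt_ofChart I H)
      contDiffAt_snd.contMDiffAt
  exact ContMDiffAt.comp (chartOne I H, chartOne I H) (contMDiffAt_chart_one I H (by simp)) ((h1.mul h2).mul h1.inv)

theorem mdifferentiable_conj (g : H) : MDifferentiable I I (fun h : H => g * h * g⁻¹) :=
  ((contMDiff_mul_right (I := I) (n := ∞) (a := g⁻¹)).comp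
    (contMDiff_mul_left (I := I) (n := ∞) (a := g))).mdifferentiable (by simp)

theorem Ad_one : Ad I (1 : H) = ContinuousLinearMap.id ℝ E := by
  have : (fun h : H => 1 * h * 1⁻¹) = id := by ext; simp
  rw [Ad, this]
  exact mfderiv_id

variable {H} in
theorem Ad_mul (g h : H) : Ad I (g * h) = (Ad I g).comp (Ad I h) := by
  have e : (fun k : H => g * h * k * (g * h)⁻¹)
      = (fun k : H => g * k * g⁻¹) ∘ (fun k : H => h * k * h⁻¹) := by
    ext k; simp [mul_assoc]
  have hg := mdifferentiable_conj I H g (h * 1 * h⁻¹)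
  have key := (hg.hasMFDerivAt.comp (1 : H) (mdifferentiable_conj I H h 1).hasMFDerivAt).mfderiv
  rw [← e] at key
  refine key.trans ?_
  have hh : h * 1 * h⁻¹ = 1 := by simp
  have h2 : (mfderiv I I (fun k : H => g * k * g⁻¹) (h * 1 * h⁻¹) : E →L[ℝ] E) = Ad I g := by
    rw [hh]; rfl
  exact congrArg (fun T : E →L[ℝ] E => T.comp (Ad I h)) h2

theorem chartAd_eq_fderiv (u : E) : chartAd I H u
    = fderiv ℝ (fun v => chartConj I H (u, v)) (chartOne I H) :=
  mfderiv_eq_fderiv_chart (mdifferentiable_conj I H _ _) (by simp)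

theorem eventually_chart_axis {p : E × E → Prop}
    (hp : ∀ᶠ z in 𝓝 (chartOne I H, chartOne I H), p z) :
    ∀ᶠ u in 𝓝 (chartOne I H), p (u, chartOne I H) :=
  (Continuous.prodMk_left (chartOne I H)).continuousAt.eventually hp

theorem eventually_differentiableAt {m : E × E → E} {z : E × E} (hm : ContDiffAt ℝ ∞ m z) :
    ∀ᶠ w in 𝓝 z, DifferentiableAt ℝ m w :=
  ((hm.of_le (show (1 : WithTop ℕ∞) ≤ ∞ by simp)).eventually (by simp)).mono
    fun _ h => h.differentiableAt (by simp)

theorem fderiv_axis {m : E × E → E} {u v : E} (h : DifferentiableAt ℝ m (u, v)) :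
    fderiv ℝ (fun v => m (u, v)) v
      = (fderiv ℝ m (u, v)).comp (ContinuousLinearMap.inr ℝ E E) :=
  (h.hasFDerivAt.comp (f := fun v => (u, v)) v (hasFDerivAt_prodMk_right u v)).fderiv

theorem contDiffAt_fderiv_axis {m : E × E → E} {e : E} (hm : ContDiffAt ℝ ∞ m (e, e)) :
    ContDiffAt ℝ ∞ (fun u => (fderiv ℝ m (u, e)).comp (ContinuousLinearMap.inr ℝ E E)) e :=
  ContDiffAt.clm_comp ((hm.fderiv_right (m := ∞) (by simp)).comp (f := fun u => (u, e)) e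
    (contDiffAt_id.prodMk contDiffAt_const)) contDiffAt_const

theorem contDiffAt_chartLeft : ContDiffAt ℝ ∞ (chartLeft I H) (chartOne I H) :=
  contDiffAt_fderiv_axis (contDiffAt_chartMul I H)

/-- Near the identity Ad is a partial derivative of the smooth map `chartConj`, taken at the points
(u, e). -/
theorem contDiffAt_chartAd : ContDiffAt ℝ ∞ (chartAd I H) (chartOne I H) := by
  refine (contDiffAt_fderiv_axis (contDiffAt_chartConj I H)).congr_of_eventuallyEq ?_
  filter_upwards [eventually_chart_axis I H
    (eventually_differentiableAt (contDiffAt_chartConj I H))] with u hu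
  rw [chartAd_eq_fderiv, fderiv_axis hu]

theorem chartAd_chartOne : chartAd I H (chartOne I H) = ContinuousLinearMap.id ℝ E := by
  rw [chartAd, ofChart_chartOne, Ad_one]

/-- The chart is only a partial inverse, so identities of the group pass to coordinates only near
the identity. -/
theorem eventually_chart_leftInv {X : Type*} [TopologicalSpace X] {f : X → H} {x : X}
    (hf : ContinuousAt f x) (hx : f x = 1) :
    ∀ᶠ y in 𝓝 x, ofChart I H (extChartAt I (1 : H) (f y)) = f y := by
  have : ∀ᶠ h in 𝓝 (f x), h ∈ (extChartAt I (1 : H)).source := by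
    rw [hx]; exact extChartAt_source_mem_nhds _
  exact (hf.eventually this).mono fun y hy => (extChartAt I (1 : H)).left_inv hy

theorem continuousAt_ofChart_prod : ContinuousAt
    (fun p : E × E => (ofChart I H p.1, ofChart I H p.2)) (chartOne I H, chartOne I H) :=
  ContinuousAt.prodMk
    (ContinuousAt.comp (f := Prod.fst) (continuousAt_ofChart I H) continuousAt_fst)
    (ContinuousAt.comp (f := Prod.snd) (continuousAt_ofChart I H) continuousAt_snd)

theorem eventually_ofChart_chartMul :
    ∀ᶠ p in 𝓝 (chartOne I H, chartOne I H),
      ofChart I H (chartMul I H p) = ofChart I H p.1 * ofChart I H p.2 := by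
  have := topologicalGroup_of_lieGroup I ∞ (G := H)
  exact eventually_chart_leftInv I H
    (ContinuousAt.mul (continuousAt_ofChart_prod I H).fst (continuousAt_ofChart_prod I H).snd)
    (by simp)

theorem eventually_ofChart_chartConj :
    ∀ᶠ p in 𝓝 (chartOne I H, chartOne I H),
      ofChart I H (chartConj I H p) = ofChart I H p.1 * ofChart I H p.2 * (ofChart I H p.1)⁻¹ := by
  have := topologicalGroup_of_lieGroup I ∞ (G := H)
  exact eventually_chart_leftInv I H
    (ContinuousAt.mul (ContinuousAt.mul (continuousAt_ofChart_prod I H).fst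
      (continuousAt_ofChart_prod I H).snd) (continuousAt_ofChart_prod I H).fst.inv)
    (by simp)

theorem eventually_chartMul_one : ∀ᶠ u in 𝓝 (chartOne I H), chartMul I H (u, chartOne I H) = u := by
  filter_upwards [extChartAt_target_mem_nhds (I := I) (1 : H)] with u hu
  simp only [chartMul, ofChart_chartOne, mul_one]
  exact (extChartAt I (1 : H)).right_inv hu

theorem eventually_chartMul_one_left :
    ∀ᶠ u in 𝓝 (chartOne I H), chartMul I H (chartOne I H, u) = u := by
  filter_upwards [extChartAt_target_mem_nhds (I := I) (1 : H)] with u hu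
  simp only [chartMul, ofChart_chartOne, one_mul]
  exact (extChartAt I (1 : H)).right_inv hu

theorem fderiv_chartMul_chartOne (η ζ : E) :
    fderiv ℝ (chartMul I H) (chartOne I H, chartOne I H) (η, ζ) = η + ζ := by
  have hd := ((contDiffAt_chartMul I H).differentiableAt (by simp)).hasFDerivAt
  have h1 := hd.comp (f := fun u => (u, chartOne I H)) _ (hasFDerivAt_prodMk_left _ _)
  have h2 := hd.comp (f := fun u => (chartOne I H, u)) _ (hasFDerivAt_prodMk_right _ _)
  have e1 := h1.unique ((hasFDerivAt_id _).congr_of_eventuallyEq (eventually_chartMul_one I H))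
  have e2 := h2.unique
    ((hasFDerivAt_id _).congr_of_eventuallyEq (eventually_chartMul_one_left I H))
  have k1 := congrArg (fun T : E →L[ℝ] E => T η) e1
  have k2 := congrArg (fun T : E →L[ℝ] E => T ζ) e2
  simp at k1 k2
  rw [show ((η, ζ) : E × E) = (η, 0) + (0, ζ) by simp, map_add, k1, k2]

theorem chartLeft_chartOne : chartLeft I H (chartOne I H) = ContinuousLinearMap.id ℝ E := by
  ext η
  simp [chartLeft, fderiv_chartMul_chartOne]

/-- Differentiate Ad_{gh} = Ad_g ∘ Ad_h in h at the identity: this is the equation satisfied by Ad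
along g' = g·ξ. -/
theorem fderiv_chartAd_chartLeft : ∀ᶠ u in 𝓝 (chartOne I H), ∀ ξ,
    fderiv ℝ (chartAd I H) u (chartLeft I H u ξ) = (chartAd I H u).comp (ad I H ξ) := by
  have hd := (((contDiffAt_chartAd I H).of_le (show (1 : WithTop ℕ∞) ≤ ∞ by simp)).eventually
    (by simp))
  filter_upwards [hd, eventually_chartMul_one I H,
    eventually_chart_axis I H (eventually_differentiableAt (contDiffAt_chartMul I H)),
    eventually_chart_axis I H (eventually_ofChart_chartMul I H).eventually_nhds]
    with u hu hu1 hm hmul ξ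
  have hA : HasFDerivAt (chartAd I H) (fderiv ℝ (chartAd I H) u)
      (chartMul I H (u, chartOne I H)) := by
    rw [hu1]; exact (hu.differentiableAt (by simp)).hasFDerivAt
  have h1 := hA.comp (f := fun v => chartMul I H (u, v)) _
    (hm.hasFDerivAt.comp (f := fun v => (u, v)) _ (hasFDerivAt_prodMk_right u _))
  have h0 : HasFDerivAt (chartAd I H) (ad I H) (chartOne I H) :=
    ((contDiffAt_chartAd I H).differentiableAt (by simp)).hasFDerivAt
  have h2 := (ContinuousLinearMap.compL ℝ E E E (chartAd I H u)).hasFDerivAt.comp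
    (f := chartAd I H) _ h0
  have e : (chartAd I H) ∘ (fun v => chartMul I H (u, v)) =ᶠ[𝓝 (chartOne I H)]
      (ContinuousLinearMap.compL ℝ E E E (chartAd I H u)) ∘ chartAd I H := by
    filter_upwards [(Continuous.prodMk_right u).continuousAt.eventually hmul] with v hv
    simp only [Function.comp, ContinuousLinearMap.compL_apply, chartAd, hv, Ad_mul]
  exact congrArg (fun T : E →L[ℝ] E →L[ℝ] E => T ξ) ((h1.congr_of_eventuallyEq e.symm).unique h2)

/-- Differentiate (u v u⁻¹) u = u v in v at the identity. It provides the intertwining hypothesis of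
`fderiv_intertwiner`. -/
theorem chartAd_intertwines : ∀ᶠ u in 𝓝 (chartOne I H), ∀ η,
    fderiv ℝ (chartMul I H) (chartOne I H, u) (chartAd I H u η, 0)
      = fderiv ℝ (chartMul I H) (u, chartOne I H) (0, η) := by
  filter_upwards [
    (Continuous.prodMk_right (chartOne I H)).continuousAt.eventually
      (eventually_differentiableAt (contDiffAt_chartMul I H)),
    eventually_chart_axis I H (eventually_differentiableAt (contDiffAt_chartMul I H)),
    eventually_chart_axis I H (eventually_differentiableAt (contDiffAt_chartConj I H)),
    eventually_chart_axis I H (eventually_ofChart_chartConj I H).eventually_nhds]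
    with u hm1 hm2 hc hconj η
  have e1 : chartConj I H (u, chartOne I H) = chartOne I H := by
    simp only [chartConj, ofChart_chartOne, mul_one, mul_inv_cancel]
    rfl
  have hm1' : HasFDerivAt (chartMul I H) (fderiv ℝ (chartMul I H) (chartOne I H, u))
      (chartConj I H (u, chartOne I H), u) := by
    rw [e1]; exact hm1.hasFDerivAt
  have h1 := hm1'.comp (f := fun v => (chartConj I H (u, v), u)) (chartOne I H)
    (((hc.hasFDerivAt.comp (f := fun v => (u, v)) _ (hasFDerivAt_prodMk_right u _))).prodMk
      (hasFDerivAt_const u _))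
  have h2 := hm2.hasFDerivAt.comp (f := fun v => (u, v)) _ (hasFDerivAt_prodMk_right u _)
  have e : (chartMul I H) ∘ (fun v => (u, v)) =ᶠ[𝓝 (chartOne I H)]
      (chartMul I H) ∘ (fun v => (chartConj I H (u, v), u)) := by
    filter_upwards [(Continuous.prodMk_right u).continuousAt.eventually hconj] with v hv
    simp [chartMul, hv]
  have key := congrArg (fun T : E →L[ℝ] E => T η) ((h1.congr_of_eventuallyEq e).unique h2)
  simp at key
  rw [chartAd_eq_fderiv, fderiv_axis hc]
  simpa using key

theorem ad_eq_sub (ξ η : E) : ad I H ξ η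
    = fderiv ℝ (fun u => chartLeft I H u η) (chartOne I H) ξ
      - fderiv ℝ (fun u => chartLeft I H u ξ) (chartOne I H) η :=
  fderiv_intertwiner ((contDiffAt_chartMul I H).of_le (by norm_cast))
    (fun η => by simp [fderiv_chartMul_chartOne])
    ((contDiffAt_chartAd I H).differentiableAt (by simp)) (chartAd_chartOne I H)
    (chartAd_intertwines I H) ξ η

/-- Pulling back by the inverse chart means applying the derivative of the chart, and the chain rule
gives the derivative of v ↦ u v at the identity. -/
theorem mpullback_mulInvariantVectorField_chart (ξ : E) :
    ∀ᶠ u in 𝓝 (chartOne I H),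
      (VectorField.mpullbackWithin 𝓘(ℝ, E) I (extChartAt I (1 : H)).symm
        (mulInvariantVectorField (I := I) (G := H) ξ) (range I) u : E) = chartLeft I H u ξ := by
  have := topologicalGroup_of_lieGroup I ∞ (G := H)
  have : IsManifold I ∞ H := IsManifold.of_le (m := ∞) (n := ∞) le_rfl
  have : IsManifold I 1 H := IsManifold.of_le (m := 1) (n := ∞) (by norm_cast)
  filter_upwards [extChartAt_target_mem_nhds (I := I) (1 : H),
    eventually_chart_axis I H (eventually_differentiableAt (contDiffAt_chartMul I H))] with u hu hm
  have hs : (extChartAt I (1 : H)).symm u ∈ (extChartAt I (1 : H)).source :=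
    (extChartAt I (1 : H)).map_target hu
  rw [VectorField.mpullbackWithin_apply, ContinuousLinearMap.inverse_eq
    (mfderivWithin_extChartAt_symm_comp_mfderiv_extChartAt hu)
    (mfderiv_extChartAt_comp_mfderivWithin_extChartAt_symm hu)]
  have hψ : HasMFDerivAt I 𝓘(ℝ, E) (extChartAt I (1 : H))
      ((extChartAt I (1 : H)).symm u * 1)
      (mfderiv I 𝓘(ℝ, E) (extChartAt I (1 : H)) ((extChartAt I (1 : H)).symm u)) := by
    rw [mul_one]
    exact (mdifferentiableAt_extChartAt (by simpa using hs)).hasMFDerivAt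
  have hL : HasMFDerivAt I I (fun h : H => (extChartAt I (1 : H)).symm u * h) 1
      (mfderiv I I (fun h : H => (extChartAt I (1 : H)).symm u * h) 1) :=
    ((contMDiff_mul_left (I := I) (n := ∞)).mdifferentiable (by simp) _).hasMFDerivAt
  have h1 := (hψ.comp 1 hL).2
  rw [ModelWithCorners.Boundaryless.range_eq_univ] at h1
  have h2 := hm.hasFDerivAt.comp (f := fun v => (u, v)) _ (hasFDerivAt_prodMk_right u _)
  exact congrArg (fun T : E →L[ℝ] E => T ξ)
    (HasFDerivAt.unique (hasFDerivWithinAt_univ (E := E) (F := E).1 h1) h2)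

/-- The bracket of the two left-invariant fields, computed in coordinates at the identity, is the
antisymmetrised derivative of `chartLeft` that `ad_eq_sub` equates with the derivative of Ad. -/
theorem lieBr_eq_ad (ξ η : E) : lieBr I H ξ η = ad I H ξ η := by
  have := topologicalGroup_of_lieGroup I ∞ (G := H)
  have : IsManifold I 1 H := IsManifold.of_le (m := 1) (n := ∞) (by norm_cast)
  let V (ζ : E) : E → E := VectorField.mpullbackWithin 𝓘(ℝ, E) I (extChartAt I (1 : H)).symm
    (mulInvariantVectorField (I := I) (G := H) ζ) (range I)
  let T : E →L[ℝ] E := mfderiv I 𝓘(ℝ, E) (extChartAt I (1 : H)) 1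
  have hT : T = ContinuousLinearMap.id ℝ E := mfderiv_extChartAt_self
  have h : lieBr I H ξ η = T.inverse (VectorField.lieBracketWithin ℝ (V ξ) (V η)
      ((extChartAt I (1 : H)).symm ⁻¹' univ ∩ range I) (chartOne I H)) := rfl
  have hV (ζ : E) : V ζ =ᶠ[𝓝 (chartOne I H)] fun u => chartLeft I H u ζ :=
    mpullback_mulInvariantVectorField_chart I H ζ
  rw [h, hT, preimage_univ, univ_inter, ModelWithCorners.Boundaryless.range_eq_univ,
    VectorField.lieBracketWithin_univ, ContinuousLinearMap.inverse_id,
    ContinuousLinearMap.id_apply, VectorField.lieBracket_eq]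
  beta_reduce
  rw [(hV ξ).fderiv_eq, (hV η).fderiv_eq,
    (hV ξ).self_of_nhds, (hV η).self_of_nhds, ad_eq_sub]
  simp only [chartLeft_chartOne, ContinuousLinearMap.id_apply]

end Group

/-! ### Coadjoint orbits and the coadjoint flow -/

section Orbit

open Metric
open scoped NNReal

set_option linter.unusedSectionVars false

/-- The solution is a fixed point in a space of curves confined to the ball. The confinement matters
because the formulas for Ad in coordinates are known only there. -/
theorem IsPicardLindelof.exists_hasDerivWithinAt_mem_closedBall {E : Type*}
    [NormedAddCommGroup E] [NormedSpace ℝ E] [CompleteSpace E] {f : ℝ → E → E} {tmin tmax : ℝ}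
    {t₀ : Icc tmin tmax} {x₀ : E} {a L K : ℝ≥0} (hf : IsPicardLindelof f t₀ x₀ a 0 L K) :
    ∃ α : ℝ → E, α t₀ = x₀ ∧ ∀ t ∈ Icc tmin tmax, α t ∈ closedBall x₀ a ∧
      HasDerivWithinAt α (f t (α t)) (Icc tmin tmax) t := by
  have hx : x₀ ∈ closedBall x₀ ((0 : ℝ≥0) : ℝ) := mem_closedBall_self le_rfl
  obtain ⟨α, hα⟩ := ODE.FunSpace.exists_isFixedPt_next hf hx
  refine ⟨α.compProj, by rw [ODE.FunSpace.compProj_val, ← hα, ODE.FunSpace.next_apply₀],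
    fun t ht => ⟨α.compProj_mem_closedBall hf.mul_max_le, ?_⟩⟩
  refine (ODE.hasDerivWithinAt_picard_Icc t₀.2 hf.continuousOn_uncurry
    α.continuous_compProj.continuousOn (fun _ _ => α.compProj_mem_closedBall hf.mul_max_le)
    x₀ ht).congr_of_mem (fun t' ht' => ?_) ht
  nth_rw 1 [← hα]
  rw [ODE.FunSpace.compProj_of_mem ht', ODE.FunSpace.next_apply]

variable {E : Type*} [NormedAddCommGroup E] [NormedSpace ℝ E] [FiniteDimensional ℝ E]
  {A : Type*} [TopologicalSpace A] (I : ModelWithCorners ℝ E A) [I.Boundaryless]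
  (H : Type*) [TopologicalSpace H] [ChartedSpace A H] [Group H] [LieGroup I ∞ H]

variable {H} in
theorem comp_Ad_mem_coadjointOrbit (μ : E →L[ℝ] ℝ) (g : H) :
    μ.comp (Ad I g) ∈ coadjointOrbit I H μ := ⟨g⁻¹, by rw [inv_inv]⟩

theorem mem_coadjointOrbit_self (μ : E →L[ℝ] ℝ) : μ ∈ coadjointOrbit I H μ := by
  simpa [Ad_one] using comp_Ad_mem_coadjointOrbit I μ (1 : H)

variable {I H} in
theorem coadjointOrbit_trans {μ ν κ : E →L[ℝ] ℝ} (h : ν ∈ coadjointOrbit I H μ)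
    (h' : κ ∈ coadjointOrbit I H ν) : κ ∈ coadjointOrbit I H μ := by
  obtain ⟨g, rfl⟩ := h
  obtain ⟨k, rfl⟩ := h'
  rw [ContinuousLinearMap.comp_assoc, ← Ad_mul]
  exact comp_Ad_mem_coadjointOrbit I μ _

/-- A curve in coordinates that is driven by the left-invariant vector fields gives, through the
adjoint representation, solutions of the coadjoint equation. -/
theorem hasDerivWithinAt_comp_chartAd (μ : E →L[ℝ] ℝ) {u : ℝ → E} {ξ : E} {s : Set ℝ} {t : ℝ}
    (hd : DifferentiableAt ℝ (chartAd I H) (u t))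
    (hu : HasDerivWithinAt u (chartLeft I H (u t) ξ) s t)
    (h : fderiv ℝ (chartAd I H) (u t) (chartLeft I H (u t) ξ)
      = (chartAd I H (u t)).comp (ad I H ξ)) :
    HasDerivWithinAt (fun τ => μ.comp (chartAd I H (u τ)))
      ((μ.comp (chartAd I H (u t))).comp (ad I H ξ)) s t := by
  have h1 := (ContinuousLinearMap.compL ℝ E E ℝ μ).hasFDerivAt.comp_hasDerivWithinAt t
    (hd.hasFDerivAt.comp_hasDerivWithinAt t hu)
  rw [h] at h1
  exact h1

/-- A single ball that carries the constants for Picard–Lindelöf and the differential equation of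
Ad. The length of the time steps will depend on r, C and a bound on ξ only. -/
theorem exists_closedBall_chart : ∃ (r C K : ℝ≥0), 0 < r ∧
    LipschitzOnWith K (chartLeft I H) (closedBall (chartOne I H) r) ∧
    ∀ u ∈ closedBall (chartOne I H) r, ‖chartLeft I H u‖ ≤ C ∧
      DifferentiableAt ℝ (chartAd I H) u ∧
      ∀ ξ, fderiv ℝ (chartAd I H) u (chartLeft I H u ξ)
        = (chartAd I H u).comp (ad I H ξ) := by
  have hL := contDiffAt_chartLeft I H
  obtain ⟨K, s, hs, hK⟩ := (hL.of_le (by norm_cast : (1 : WithTop ℕ∞) ≤ ∞)).exists_lipschitzOnWith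
  have hA := ((contDiffAt_chartAd I H).of_le (by norm_cast : (1 : WithTop ℕ∞) ≤ ∞)).eventually
    (by simp)
  have hC : ∀ᶠ u in 𝓝 (chartOne I H), ‖chartLeft I H u‖ ≤ ‖chartLeft I H (chartOne I H)‖₊ + 1 := by
    refine (hL.continuousAt.norm.eventually (gt_mem_nhds (lt_add_one _))).mono fun u hu => hu.le
  obtain ⟨r, hr, h⟩ := nhds_basis_closedBall.mem_iff.1
    (inter_mem hs ((hA.and hC).and (fderiv_chartAd_chartLeft I H)))
  refine ⟨⟨r, hr.le⟩, ‖chartLeft I H (chartOne I H)‖₊ + 1, K, hr,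
    hK.mono fun u hu => (h hu).1, fun u hu => ?_⟩
  obtain ⟨-, ⟨h1, h2⟩, h3⟩ := h hu
  exact ⟨by exact_mod_cast h2, h1.differentiableAt (by simp), h3⟩

/-- The coadjoint equation preserves the coadjoint orbits. -/
theorem mem_coadjointOrbit_of_hasDerivWithinAt {μ : ℝ → E →L[ℝ] ℝ} {ξ : ℝ → E} {a b : ℝ}
    (hab : a ≤ b) (hξ : ContinuousOn ξ (Icc a b))
    (hμ : ∀ t ∈ Icc a b, HasDerivWithinAt μ ((μ t).comp (ad I H (ξ t))) (Icc a b) t) :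
    μ b ∈ coadjointOrbit I H (μ a) := by
  obtain ⟨r, C, K, hr, hK, hball⟩ := exists_closedBall_chart I H
  obtain ⟨B₀, hB₀⟩ := isCompact_Icc.exists_bound_of_continuousOn hξ
  obtain ⟨B, hB⟩ : ∃ B : ℝ≥0, ∀ t ∈ Icc a b, ‖ξ t‖ ≤ B :=
    ⟨B₀.toNNReal, fun t ht => (hB₀ t ht).trans (Real.le_coe_toNNReal _)⟩
  -- Each step restarts at the identity of H, so the admissible step length is the same at every
  -- time s.
  have step : ∀ s ∈ Icc a b, ∀ t ∈ Icc a b, s ≤ t → C * B * (t - s) ≤ r →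
      μ t ∈ coadjointOrbit I H (μ s) := by
    intro s hs t ht hst hr'
    have hsub : Icc s t ⊆ Icc a b := Icc_subset_Icc hs.1 ht.2
    have hPL : IsPicardLindelof (fun τ u => chartLeft I H u (ξ τ)) (tmin := s) (tmax := t)
        ⟨s, left_mem_Icc.2 hst⟩ (chartOne I H) r 0 (C * B) (K * B) :=
      { lipschitzOnWith := fun τ hτ => LipschitzOnWith.of_dist_le_mul fun u hu v hv => by
          rw [dist_eq_norm, ← sub_apply]
          refine (ContinuousLinearMap.le_opNorm _ _).trans ?_
          have := hK.dist_le_mul u hu v hv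
          rw [dist_eq_norm] at this
          calc _ ≤ (K * dist u v) * B := by gcongr; exact hB τ (hsub hτ)
            _ = _ := by push_cast; ring
        continuousOn := fun u _ => (chartLeft I H u).continuous.comp_continuousOn (hξ.mono hsub)
        norm_le := fun τ hτ u hu => (ContinuousLinearMap.le_opNorm _ _).trans <| by
          push_cast
          exact mul_le_mul (hball u hu).1 (hB τ (hsub hτ)) (norm_nonneg _) C.2
        mul_max_le := by
          simpa [hst] using hr' }
    obtain ⟨u, hu0, hu⟩ := IsPicardLindelof.exists_hasDerivWithinAt_mem_closedBall hPL
    have hν : ∀ τ ∈ Icc s t, HasDerivWithinAt (fun τ => (μ s).comp (chartAd I H (u τ)))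
        (((μ s).comp (chartAd I H (u τ))).comp (ad I H (ξ τ))) (Icc s t) τ := fun τ hτ =>
      have h := hball _ (hu τ hτ).1
      hasDerivWithinAt_comp_chartAd I H (μ s) h.2.1 (hu τ hτ).2 (h.2.2 _)
    have hμ' : ∀ τ ∈ Icc s t, HasDerivWithinAt μ ((μ τ).comp (ad I H (ξ τ))) (Icc s t) τ :=
      fun τ hτ => (hμ τ (hsub hτ)).mono hsub
    -- The uniqueness theorem asks for derivatives from the right on [s, t).
    have hIci {f : ℝ → E →L[ℝ] ℝ} {f' : E →L[ℝ] ℝ} {τ : ℝ} (hτ : τ ∈ Ico s t)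
        (h : HasDerivWithinAt f f' (Icc s t) τ) : HasDerivWithinAt f f' (Ici τ) τ :=
      h.mono_of_mem_nhdsWithin (Icc_mem_nhdsGE_of_mem hτ)
    have key := ODE_solution_unique_of_mem_Icc_right (K := ‖ad I H‖₊ * B) (s := fun _ => univ)
      (v := fun τ ν => ν.comp (ad I H (ξ τ)))
      (fun τ hτ => LipschitzOnWith.of_dist_le_mul fun ν _ κ _ => by
        rw [dist_eq_norm, ← ContinuousLinearMap.sub_comp, dist_eq_norm]
        calc ‖(ν - κ).comp (ad I H (ξ τ))‖ ≤ ‖ν - κ‖ * (‖ad I H‖ * ‖ξ τ‖) :=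
              (ContinuousLinearMap.opNorm_comp_le _ _).trans (by
                gcongr; exact ContinuousLinearMap.le_opNorm _ _)
          _ ≤ ‖ν - κ‖ * (‖ad I H‖ * B) := by gcongr; exact hB τ (hsub (Ico_subset_Icc_self hτ))
          _ = _ := by push_cast; ring)
      (fun τ hτ => (hμ' τ hτ).continuousWithinAt)
      (fun τ hτ => hIci hτ (hμ' τ (Ico_subset_Icc_self hτ))) (fun _ _ => mem_univ _)
      (fun τ hτ => (hν τ hτ).continuousWithinAt)
      (fun τ hτ => hIci hτ (hν τ (Ico_subset_Icc_self hτ))) (fun _ _ => mem_univ _)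
      (by
        have : u s = chartOne I H := hu0
        rw [this, chartAd_chartOne, ContinuousLinearMap.comp_id])
      (right_mem_Icc.2 hst)
    rw [key]
    exact comp_Ad_mem_coadjointOrbit I _ _
  -- With n equal steps, each has length (b - a) / n and so meets the bound C * B * (t - s) ≤ r.
  obtain ⟨n, hn⟩ := exists_nat_gt (C * B * (b - a) / r)
  have hr0 : (0 : ℝ) < r := hr
  have hba : 0 ≤ b - a := sub_nonneg.2 hab
  have hn0 : (0 : ℝ) < n := lt_of_le_of_lt (by positivity) hn
  have hp (k : ℕ) (hk : k ≤ n) : a + k * ((b - a) / n) ∈ Icc a b := by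
    have hk' : (k : ℝ) ≤ n := by exact_mod_cast hk
    refine ⟨le_add_of_nonneg_right (by positivity), ?_⟩
    have : k * ((b - a) / n) ≤ n * ((b - a) / n) := by gcongr
    rw [mul_div_cancel₀ _ hn0.ne'] at this
    linarith
  have hind : ∀ k : ℕ, k ≤ n → μ (a + k * ((b - a) / n)) ∈ coadjointOrbit I H (μ a) := by
    intro k
    induction k with
    | zero => intro _; simpa using mem_coadjointOrbit_self I H (μ a)
    | succ k ih =>
      intro hk
      refine coadjointOrbit_trans (ih (by omega)) (step _ (hp k (by omega)) _ (hp _ hk) ?_ ?_)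
      · push_cast; gcongr; linarith
      · have h1 : C * B * (b - a) < n * r := (div_lt_iff₀ hr0).1 hn
        have h2 : a + ((k + 1 : ℕ) : ℝ) * ((b - a) / n) - (a + k * ((b - a) / n)) = (b - a) / n := by
          push_cast; ring
        rw [h2, ← mul_div_assoc, div_le_iff₀ hn0]
        linarith
  have := hind n le_rfl
  rwa [mul_div_cancel₀ _ hn0.ne', add_sub_cancel] at this

end Orbit

/-! ### One-parameter subgroups generate a connected Lie group -/

section Generation

set_option linter.unusedSectionVars false

variable {E : Type*} [NormedAddCommGroup E] [NormedSpace ℝ E] [FiniteDimensional ℝ E]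
  {A : Type*} [TopologicalSpace A] (I : ModelWithCorners ℝ E A) [I.Boundaryless]
  (H : Type*) [TopologicalSpace H] [ChartedSpace A H] [Group H] [LieGroup I ∞ H]

/-- Local one-parameter subgroups, in the chart at the identity. -/
theorem exists_chart_flow (ξ : E) : ∃ u : ℝ → E, u 0 = chartOne I H ∧ HasStrictDerivAt u ξ 0 ∧
    ∀ᶠ t in 𝓝 0, HasDerivAt u (chartLeft I H (u t) ξ) t := by
  have hf : ContDiffAt ℝ ∞ (fun u => chartLeft I H u ξ) (chartOne I H) :=
    (contDiffAt_chartLeft I H).clm_apply contDiffAt_const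
  obtain ⟨u, hu0, ε, hε, hu⟩ :=
    (hf.of_le (by norm_cast : (1 : WithTop ℕ∞) ≤ ∞)).exists_forall_mem_closedBall_exists_eq_forall_mem_Ioo_hasDerivAt₀ 0
  have hev : ∀ᶠ t in 𝓝 (0 : ℝ), HasDerivAt u (chartLeft I H (u t) ξ) t :=
    eventually_of_mem (Ioo_mem_nhds (by linarith) (by linarith)) hu
  have hc : ContinuousAt (fun t => chartLeft I H (u t) ξ) 0 :=
    ContinuousAt.comp (f := u) (g := fun u => chartLeft I H u ξ)
      (by rw [hu0]; exact hf.continuousAt) hev.self_of_nhds.continuousAt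
  have h := hasStrictDerivAt_of_hasDerivAt_of_continuousAt hev hc
  rw [hu0, chartLeft_chartOne] at h
  exact ⟨u, hu0, h, hev⟩

/-- A submonoid of a Lie group which contains small pieces of curves through the identity in all
directions is a neighbourhood of the identity. -/
theorem submonoid_mem_nhds_one {S : Submonoid H}
    (hS : ∀ ξ : E, ∃ u : ℝ → E, u 0 = chartOne I H ∧ HasStrictDerivAt u ξ 0 ∧
      ∀ᶠ t in 𝓝 0, ofChart I H (u t) ∈ S) : (S : Set H) ∈ 𝓝 1 := by
  choose u hu0 hu hmem using hS
  let b := Module.finBasis ℝ E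
  let c (i) : E →L[ℝ] ℝ := LinearMap.toContinuousLinearMap (b.coord i)
  -- Φ is a product of the curves for the basis vectors in s, each run for the time given by the
  -- corresponding coordinate of x. Its derivative at 0 is the projection onto their span.
  have key : ∀ s : Finset (Fin (Module.finrank ℝ E)), ∃ Φ : E → E, Φ 0 = chartOne I H ∧
      HasStrictFDerivAt Φ (∑ i ∈ s, (c i).smulRight (b i)) 0 ∧
      ∀ᶠ x in 𝓝 0, ofChart I H (Φ x) ∈ S := by
    intro s
    induction s using Finset.induction_on with
    | empty =>
      exact ⟨fun _ => chartOne I H, rfl, by simpa using hasStrictFDerivAt_const _ _,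
        Eventually.of_forall fun _ => by rw [ofChart_chartOne]; exact S.one_mem⟩
    | insert i s his ih =>
      obtain ⟨Φ, h0, hd, hm⟩ := ih
      have hci : ContinuousAt (c i) 0 := (c i).continuous.continuousAt
      have hui : HasStrictFDerivAt (fun x => u (b i) (c i x)) ((c i).smulRight (b i)) 0 := by
        have h1 : HasStrictDerivAt (u (b i)) (b i) (c i 0) := by rw [map_zero]; exact hu (b i)
        exact h1.hasStrictFDerivAt.comp (0 : E) (c i).hasStrictFDerivAt
      have hpair := hd.prodMk hui
      have e0 : (Φ 0, u (b i) (c i 0)) = (chartOne I H, chartOne I H) := by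
        rw [h0, map_zero, hu0]
      refine ⟨fun x => chartMul I H (Φ x, u (b i) (c i x)), ?_, ?_, ?_⟩
      · beta_reduce
        rw [e0]
        exact (eventually_chartMul_one I H).self_of_nhds
      · have h1 : HasStrictFDerivAt (chartMul I H) (fderiv ℝ (chartMul I H)
            (chartOne I H, chartOne I H)) (Φ 0, u (b i) (c i 0)) := by
          rw [e0]
          exact (contDiffAt_chartMul I H).hasStrictFDerivAt (by simp)
        convert! h1.comp (0 : E) hpair using 1
        ext x
        rw [Finset.sum_insert his]
        simp only [ContinuousLinearMap.comp_apply, ContinuousLinearMap.prod_apply,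
          fderiv_chartMul_chartOne, add_apply]
        rw [add_comm]
      · have hc : ContinuousAt (fun x => (Φ x, u (b i) (c i x))) 0 := hpair.continuousAt
        have h1 := hc.eventually (p := fun p => ofChart I H (chartMul I H p)
          = ofChart I H p.1 * ofChart I H p.2) (by
            beta_reduce; rw [e0]; exact eventually_ofChart_chartMul I H)
        have h2 := hci.eventually (p := fun t => ofChart I H (u (b i) t) ∈ S)
          (by rw [map_zero]; exact hmem (b i))
        filter_upwards [h1, h2, hm] with x h1 h2 h3
        rw [h1]
        exact S.mul_mem h3 h2
  obtain ⟨Φ, h0, hd, hm⟩ := key Finset.univ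
  have hid : ∑ i, (c i).smulRight (b i) = ContinuousLinearMap.id ℝ E := by
    ext x
    simp [c]
  rw [hid] at hd
  -- For the full basis the strict derivative is the identity, so Φ maps neighbourhoods of 0 onto
  -- neighbourhoods of the identity.
  have hmap := hd.map_nhds_eq_of_surj (by simp)
  rw [h0] at hmap
  have hnear : ∀ᶠ v in 𝓝 (chartOne I H), ofChart I H v ∈ S := by
    rw [← hmap]; exact hm
  have h1 := (continuousAt_extChartAt (I := I) (1 : H)).eventually hnear
  filter_upwards [h1, eventually_chart_leftInv I H (f := id) continuousAt_id rfl] with g h1 h2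
  exact (congrArg (· ∈ S) h2).mp h1

/-- S ∩ S⁻¹ is a subgroup that is a neighbourhood of 1, hence open, hence closed, hence everything
by connectedness. -/
theorem mem_submonoid_of_mem_nhds_one {G : Type*} [Group G] [TopologicalSpace G]
    [IsTopologicalGroup G] [ConnectedSpace G] {S : Submonoid G} (hS : (S : Set G) ∈ 𝓝 1) (g : G) :
    g ∈ S := by
  let T : Subgroup G :=
    { carrier := {g | g ∈ S ∧ g⁻¹ ∈ S}
      one_mem' := ⟨S.one_mem, by simp⟩
      mul_mem' := fun ha hb => ⟨S.mul_mem ha.1 hb.1, by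
        rw [mul_inv_rev]; exact S.mul_mem hb.2 ha.2⟩
      inv_mem' := fun ha => ⟨ha.2, by simpa using ha.1⟩ }
  have hT : (T : Set G) ∈ 𝓝 1 :=
    inter_mem hS (continuous_inv.continuousAt.preimage_mem_nhds (by rw [inv_one]; exact hS))
  have hopen : IsOpen (T : Set G) := T.isOpen_of_mem_nhds hT
  have huniv := IsClopen.eq_univ ⟨T.isClosed_of_isOpen hopen, hopen⟩ ⟨1, T.one_mem⟩
  exact (show g ∈ (T : Set G) by rw [huniv]; exact mem_univ g).1

/-- A reflexive and transitive relation on `𝔥*` that contains the trajectories of the coadjoint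
equation for constant elements of `𝔥` relates any two points of a coadjoint orbit. -/
theorem coadjointOrbit_induction [ConnectedSpace H] {R : (E →L[ℝ] ℝ) → (E →L[ℝ] ℝ) → Prop}
    (hrefl : ∀ μ, R μ μ) (htrans : ∀ μ ν κ, R μ ν → R ν κ → R μ κ)
    (hflow : ∀ (ξ : E) (γ : ℝ → E →L[ℝ] ℝ), (∀ t ∈ Icc (0 : ℝ) 1,
      HasDerivWithinAt γ ((γ t).comp (ad I H ξ)) (Icc 0 1) t) → R (γ 0) (γ 1))
    {μ ν : E →L[ℝ] ℝ} (h : ν ∈ coadjointOrbit I H μ) : R μ ν := by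
  -- R need not be symmetric, so the elements g that it accepts form a submonoid only.
  let S : Submonoid H :=
    { carrier := {g | ∀ μ, R μ (μ.comp (Ad I g))}
      one_mem' := fun μ => by simpa [Ad_one] using hrefl μ
      mul_mem' := fun {g k} hg hk μ => by
        rw [Ad_mul, ← ContinuousLinearMap.comp_assoc]
        exact htrans _ _ _ (hg μ) (hk _) }
  have hS : (S : Set H) ∈ 𝓝 1 := by
    refine submonoid_mem_nhds_one I H fun ξ => ?_
    obtain ⟨u, hu0, hu, hflow'⟩ := exists_chart_flow I H ξ
    refine ⟨u, hu0, hu, ?_⟩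
    have hd := ((contDiffAt_chartAd I H).of_le (by norm_cast : (1 : WithTop ℕ∞) ≤ ∞)).eventually
      (by simp)
    have hgood := hu.hasDerivAt.continuousAt.eventually
      (p := fun v => DifferentiableAt ℝ (chartAd I H) v ∧ ∀ ξ,
        fderiv ℝ (chartAd I H) v (chartLeft I H v ξ) = (chartAd I H v).comp (ad I H ξ)) (by
        rw [hu0]
        exact (hd.mono fun v hv => hv.differentiableAt (by simp)).and
          (fderiv_chartAd_chartLeft I H))
    obtain ⟨ε, hε, hball⟩ := Metric.eventually_nhds_iff_ball.1 (hflow'.and hgood)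
    refine Metric.eventually_nhds_iff_ball.2 ⟨ε, hε, fun t ht μ => ?_⟩
    have hmem : ∀ s ∈ Icc (0 : ℝ) 1, s * t ∈ Metric.ball (0 : ℝ) ε := by
      intro s hs
      rw [mem_ball_zero_iff] at ht ⊢
      rw [norm_mul, Real.norm_of_nonneg hs.1]
      exact (mul_le_of_le_one_left (norm_nonneg t) hs.2).trans_lt ht
    -- Rescaling time by the small number t, possibly negative, turns the piece from 0 to t into a
    -- trajectory over [0, 1] for t • ξ.
    have key := hflow (t • ξ) (fun s => μ.comp (chartAd I H (u (s * t)))) fun s hs => by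
      obtain ⟨h1, h2, h3⟩ := hball _ (hmem s hs)
      have h4 : HasDerivAt (fun s => u (s * t)) (chartLeft I H (u (s * t)) (t • ξ)) s := by
        rw [map_smul]
        simpa [Function.comp_def] using h1.scomp s ((hasDerivAt_id s).mul_const t)
      exact hasDerivWithinAt_comp_chartAd I H μ (u := fun s => u (s * t)) h2
        h4.hasDerivWithinAt (h3 _)
    simp only [zero_mul, one_mul, hu0, chartAd_chartOne, ContinuousLinearMap.comp_id] at key
    exact key
  obtain ⟨g, rfl⟩ := h
  have := topologicalGroup_of_lieGroup I ∞ (G := H)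
  exact mem_submonoid_of_mem_nhds_one hS g⁻¹ μ

end Generation

/-! ### Hamiltonian vector fields of the uncoupled bracket -/

section Hamiltonian

set_option linter.unusedSectionVars false

variable {E : Type*} [NormedAddCommGroup E] [NormedSpace ℝ E] [FiniteDimensional ℝ E]
  {A : Type*} [TopologicalSpace A] (I : ModelWithCorners ℝ E A) [I.Boundaryless]
  (H : Type*) [TopologicalSpace H] [ChartedSpace A H] [Group H] [LieGroup I ∞ H]
  {F : Type*} [NormedAddCommGroup F] [NormedSpace ℝ F] [FiniteDimensional ℝ F]
  {C : Type*} [TopologicalSpace C] {J : ModelWithCorners ℝ F C} [J.Boundaryless]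
  {P : Type*} [TopologicalSpace P] [ChartedSpace C P] [IsManifold J ∞ P]

theorem apply_funcDeriv (f : (E →L[ℝ] ℝ) → ℝ) (μ ν : E →L[ℝ] ℝ) :
    ν (funcDeriv f μ) = fderiv ℝ f μ ν :=
  congrArg (fun T : (E →L[ℝ] ℝ) →L[ℝ] ℝ => T ν) ((bidual E).apply_symm_apply (fderiv ℝ f μ))

theorem funcDeriv_apply (ξ : E) (μ : E →L[ℝ] ℝ) :
    funcDeriv (fun ν : E →L[ℝ] ℝ => ν ξ) μ = ξ := by
  rw [funcDeriv, LinearEquiv.symm_apply_eq]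
  exact ((ContinuousLinearMap.apply ℝ ℝ ξ).hasFDerivAt (x := μ)).fderiv

theorem funcDeriv_const (c : ℝ) (μ : E →L[ℝ] ℝ) :
    funcDeriv (fun _ : E →L[ℝ] ℝ => c) μ = 0 := by
  rw [funcDeriv, fderiv_fun_const, Pi.zero_apply, map_zero]

theorem SymplecticForm.sharp_eq (Ω : SymplecticForm J P) {x : P} {v : F} {α : F →L[ℝ] ℝ}
    (h : (Ω.toFun x v : F →L[ℝ] ℝ) = α) : (Ω.sharp x α : F) = v :=
  (Ω.flat x).symm_apply_eq.2 h.symm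

theorem ad_swap (ξ η : E) : ad I H ξ η = -ad I H η ξ := by
  rw [ad_eq_sub, ad_eq_sub, neg_sub]

/-- The Hamiltonian vector field of `f` on `𝔥* × P`. -/
def hamiltonianField (Ω : SymplecticForm J P) (f : (E →L[ℝ] ℝ) × P → ℝ)
    (p : (E →L[ℝ] ℝ) × P) : TangentSpace (𝓘(ℝ, E →L[ℝ] ℝ).prod J) p :=
  ((p.1.comp (ad I H (funcDeriv (fun μ => f (μ, p.2)) p.1)),
    -(Ω.sharp p.2 (mfderiv J 𝓘(ℝ, ℝ) (fun x => f (p.1, x)) p.2) : F)) : (E →L[ℝ] ℝ) × F)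

/-- Antisymmetry gives -μ[δk/δμ, δf/δμ] = (μ ∘ ad_{δf/δμ})(δk/δμ), which is the derivative of k
along the 𝔥*-component. The minus sign of the P-bracket is that of the P-component. -/
theorem dir_hamiltonianField (Ω : SymplecticForm J P) (k f : (E →L[ℝ] ℝ) × P → ℝ)
    (p : (E →L[ℝ] ℝ) × P)
    (hk : MDifferentiableAt (𝓘(ℝ, E →L[ℝ] ℝ).prod J) 𝓘(ℝ, ℝ) k p) :
    dir k p (hamiltonianField I H Ω f p)
      = naturalBracket I H Ω (fun _ _ _ => 0) k f p := by
  have h1 := mfderiv_prod_eq_add_apply hk (v := hamiltonianField I H Ω f p)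
  rw [mfderiv_eq_fderiv] at h1
  refine h1.trans ?_
  have h2 := apply_funcDeriv (fun μ => k (μ, p.2)) p.1
    (p.1.comp (ad I H (funcDeriv (fun μ => f (μ, p.2)) p.1)))
  have h3 : liePoisson I H (fun μ => k (μ, p.2)) (fun μ => f (μ, p.2)) p.1
      = fderiv ℝ (fun μ => k (μ, p.2)) p.1
        (p.1.comp (ad I H (funcDeriv (fun μ => f (μ, p.2)) p.1))) := by
    rw [← h2, liePoisson, lieBr_eq_ad, ad_swap, map_neg, neg_neg]
    rfl
  have h4 : Ω.bracket (fun x => k (p.1, x)) (fun x => f (p.1, x)) p.2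
      = -(mfderiv J 𝓘(ℝ, ℝ) (fun x => k (p.1, x)) p.2 : F →L[ℝ] ℝ)
        (-(Ω.sharp p.2 (mfderiv J 𝓘(ℝ, ℝ) (fun x => f (p.1, x)) p.2) : F)) := by
    rw [map_neg, neg_neg]
    rfl
  rw [naturalBracket, h3, h4, sub_zero]
  exact (sub_neg_eq_add (_ : ℝ) _).symm

theorem isHamiltonianVectorField_hamiltonianField (Ω : SymplecticForm J P)
    (f : (E →L[ℝ] ℝ) × P → ℝ) (U : Set ((E →L[ℝ] ℝ) × P)) :
    IsHamiltonianVectorField (𝓘(ℝ, E →L[ℝ] ℝ).prod J)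
      (naturalBracket I H Ω (fun _ _ _ => 0)) f U (hamiltonianField I H Ω f) :=
  fun p _ k hk => dir_hamiltonianField I H Ω k f p (hk.mdifferentiableAt (by simp))

-- Testing X on the functions μ ↦ ⟨μ, η⟩ determines its 𝔥*-component, whichever Hamiltonian field
-- was chosen.
variable {I H} in
theorem IsHamiltonianVectorField.fst_eq {Ω : SymplecticForm J P} {f : (E →L[ℝ] ℝ) × P → ℝ}
    {U : Set ((E →L[ℝ] ℝ) × P)}
    {X : ∀ p : (E →L[ℝ] ℝ) × P, TangentSpace (𝓘(ℝ, E →L[ℝ] ℝ).prod J) p}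
    (hX : IsHamiltonianVectorField (𝓘(ℝ, E →L[ℝ] ℝ).prod J)
      (naturalBracket I H Ω (fun _ _ _ => 0)) f U X) {p : (E →L[ℝ] ℝ) × P} (hp : p ∈ U) :
    (show (E →L[ℝ] ℝ) × F from X p).1
      = p.1.comp (ad I H (funcDeriv (fun μ => f (μ, p.2)) p.1)) := by
  ext η
  have hk : HasMFDerivAt (𝓘(ℝ, E →L[ℝ] ℝ).prod J) 𝓘(ℝ, ℝ)
      (fun q : (E →L[ℝ] ℝ) × P => q.1 η) p
      ((ContinuousLinearMap.apply ℝ ℝ η).comp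
        (ContinuousLinearMap.fst ℝ (E →L[ℝ] ℝ) F)) :=
    ((ContinuousLinearMap.apply ℝ ℝ η).hasMFDerivAt (x := p.1)).comp p (hasMFDerivAt_fst p)
  have hs : ContMDiffAt (𝓘(ℝ, E →L[ℝ] ℝ).prod J) 𝓘(ℝ, ℝ) ∞
      (fun q : (E →L[ℝ] ℝ) × P => q.1 η) p :=
    (ContinuousLinearMap.apply ℝ ℝ η).contMDiff.contMDiffAt.comp p contMDiffAt_fst
  have h := (hX p hp _ hs).trans (dir_hamiltonianField I H Ω _ f p hk.mdifferentiableAt).symm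
  unfold dir at h
  rw [hk.mfderiv] at h
  exact h

/-- Makes ξ(t) = δf/δμ continuous along a trajectory, as the coadjoint equation requires. -/
theorem continuousAt_funcDeriv {f : (E →L[ℝ] ℝ) × P → ℝ} {p : (E →L[ℝ] ℝ) × P}
    (hf : ContMDiffAt (𝓘(ℝ, E →L[ℝ] ℝ).prod J) 𝓘(ℝ, ℝ) ∞ f p) :
    ContinuousAt (fun q => funcDeriv (fun μ => f (μ, q.2)) q.1) p := by
  have : IsManifold J 1 P := IsManifold.of_le (n := ∞) (by norm_cast)
  have h1 : ContMDiffAt ((𝓘(ℝ, E →L[ℝ] ℝ).prod J).prod 𝓘(ℝ, E →L[ℝ] ℝ)) 𝓘(ℝ, ℝ) ∞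
      (Function.uncurry fun (q : (E →L[ℝ] ℝ) × P) (μ : E →L[ℝ] ℝ) => f (μ, q.2)) (p, p.1) :=
    ContMDiffAt.comp (g := f) (f := fun z : ((E →L[ℝ] ℝ) × P) × (E →L[ℝ] ℝ) => (z.2, z.1.2))
      (p, p.1) hf (contMDiffAt_snd.prodMk (contMDiffAt_snd.comp _ contMDiffAt_fst))
  have h2 := h1.mfderiv (fun q μ => f (μ, q.2)) Prod.fst contMDiffAt_fst (m := 0) (by simp)
  simp only [inTangentCoordinates_model_space, mfderiv_eq_fderiv] at h2
  exact ((bidual E).symm.toLinearMap.continuous_of_finiteDimensional.continuousAt).comp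
    h2.continuousAt

theorem HamiltonianSegment.fst_mem_coadjointOrbit {Ω : SymplecticForm J P}
    {p q : (E →L[ℝ] ℝ) × P}
    (h : HamiltonianSegment (𝓘(ℝ, E →L[ℝ] ℝ).prod J)
      (naturalBracket I H Ω (fun _ _ _ => 0)) p q) :
    q.1 ∈ coadjointOrbit I H p.1 := by
  obtain ⟨U, f, X, γ, a, b, hU, hf, hX, hab, hγU, hγ, rfl, rfl⟩ := h
  refine mem_coadjointOrbit_of_hasDerivWithinAt I H (μ := fun t => (γ t).1)
    (ξ := fun t => funcDeriv (fun μ => f (μ, (γ t).2)) (γ t).1) hab ?_ fun t ht => ?_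
  · intro t ht
    exact (continuousAt_funcDeriv (hf.contMDiffAt (hU.mem_nhds (hγU ht)))).comp_continuousWithinAt
      (hγ t ht).continuousWithinAt
  · have h1 := (hasMFDerivAt_fst (I := 𝓘(ℝ, E →L[ℝ] ℝ)) (I' := J)
      (γ t)).comp_hasMFDerivWithinAt t (hγ t ht)
    let v : (E →L[ℝ] ℝ) × F := X (γ t)
    have h2 : HasFDerivWithinAt (fun t => (γ t).1)
        ((1 : ℝ →L[ℝ] ℝ).smulRight v.1) (Icc a b) t := h1.hasFDerivWithinAt
    have h3 := h2.hasDerivWithinAt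
    rwa [ContinuousLinearMap.smulRight_apply, show (1 : ℝ →L[ℝ] ℝ) 1 = 1 from rfl, one_smul,
      show v.1 = _ from hX.fst_eq (hγU ht)] at h3

end Hamiltonian

/-! ### Reachability -/

section Segments

set_option linter.unusedSectionVars false

/-- A smooth family of covectors `α` with `α(v) = 0` is, along each line in the direction `v`,
the differential of a smooth function. -/
theorem exists_primitive_along_line {F : Type*} [NormedAddCommGroup F] [NormedSpace ℝ F]
    {T : Set F} (hT : IsOpen T) {α : F → F →L[ℝ] ℝ} (hα : ContDiffOn ℝ ∞ α T) {v : F}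
    (hv : v ≠ 0) (hαv : ∀ u ∈ T, α u v = 0) (u₀ : F) :
    ∃ (U : Set F) (h : F → ℝ), IsOpen U ∧ ContDiffOn ℝ ∞ h U ∧ ∀ t : ℝ, u₀ + t • v ∈ T →
      u₀ + t • v ∈ U ∧ HasFDerivAt h (α (u₀ + t • v)) (u₀ + t • v) := by
  obtain ⟨ℓ, hℓ⟩ : ∃ ℓ : StrongDual ℝ F, ℓ v = 1 := SeparatingDual.exists_eq_one hv
  -- r projects onto the line u₀ + ℝv. The primitive is h(u) = α(r u)(u - u₀).
  let r : F → F := fun u => u₀ + ℓ (u - u₀) • v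
  have hr : ContDiff ℝ ∞ r := by fun_prop
  have hrU : IsOpen (r ⁻¹' T) := hT.preimage hr.continuous
  have ha : ContDiffOn ℝ ∞ (fun u => α (r u)) (r ⁻¹' T) := hα.comp hr.contDiffOn fun _ h => h
  refine ⟨r ⁻¹' T, fun u => α (r u) (u - u₀), hrU, ha.clm_apply (by fun_prop), fun t ht => ?_⟩
  have hrt : r (u₀ + t • v) = u₀ + t • v := by simp [r, hℓ]
  have hmem : u₀ + t • v ∈ r ⁻¹' T := by rw [mem_preimage, hrt]; exact ht
  refine ⟨hmem, ?_⟩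
  have hd := ((ha.contDiffAt (hrU.mem_nhds hmem)).differentiableAt (by simp)).hasFDerivAt
  -- α(r u) v vanishes identically near the point, hence so does its derivative. On the line u - u₀
  -- = t • v, so this kills the unwanted term in the product rule for h.
  have hz : HasFDerivAt (fun u => α (r u) v) (0 : F →L[ℝ] ℝ) (u₀ + t • v) :=
    (hasFDerivAt_const (0 : ℝ) _).congr_of_eventuallyEq
      (eventually_of_mem (hrU.mem_nhds hmem) fun u hu => hαv _ hu)
  have h1 := hz.unique (hd.clm_apply (hasFDerivAt_const v _))
  have h2 := hd.clm_apply ((hasFDerivAt_id (𝕜 := ℝ) (u₀ + t • v)).sub_const u₀)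
  convert! h2 using 1
  ext w
  have h3 := congrArg (fun S : F →L[ℝ] ℝ => S w) h1
  simp at h3
  simp [hrt, ← h3]

variable {E : Type*} [NormedAddCommGroup E] [NormedSpace ℝ E] [FiniteDimensional ℝ E]
  {A : Type*} [TopologicalSpace A] (I : ModelWithCorners ℝ E A) [I.Boundaryless]
  (H : Type*) [TopologicalSpace H] [ChartedSpace A H] [Group H] [LieGroup I ∞ H]
  {F : Type*} [NormedAddCommGroup F] [NormedSpace ℝ F] [FiniteDimensional ℝ F]
  {C : Type*} [TopologicalSpace C] {J : ModelWithCorners ℝ F C} [J.Boundaryless]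
  {P : Type*} [TopologicalSpace P] [ChartedSpace C P] [IsManifold J ∞ P]

/-- A curve in `𝔥* × P` whose components have the velocities prescribed by the Hamiltonian vector
field of `f` is a Hamiltonian segment. -/
theorem hamiltonianSegment_of_curve (Ω : SymplecticForm J P) {U : Set ((E →L[ℝ] ℝ) × P)}
    {f : (E →L[ℝ] ℝ) × P → ℝ} (hU : IsOpen U)
    (hf : ContMDiffOn (𝓘(ℝ, E →L[ℝ] ℝ).prod J) 𝓘(ℝ, ℝ) ∞ f U)
    {γ : ℝ → E →L[ℝ] ℝ} {c : ℝ → P} {γ' : ℝ → E →L[ℝ] ℝ} {c' : ℝ → F}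
    (hmem : ∀ t ∈ Icc (0 : ℝ) 1, (γ t, c t) ∈ U)
    (hγ : ∀ t ∈ Icc (0 : ℝ) 1, HasDerivWithinAt γ (γ' t) (Icc 0 1) t)
    (hc : ∀ t ∈ Icc (0 : ℝ) 1, HasMFDerivWithinAt 𝓘(ℝ, ℝ) J c (Icc 0 1) t
      ((1 : ℝ →L[ℝ] ℝ).smulRight (c' t) : ℝ →L[ℝ] F))
    (h1 : ∀ t ∈ Icc (0 : ℝ) 1,
      (γ t).comp (ad I H (funcDeriv (fun μ => f (μ, c t)) (γ t))) = γ' t)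
    (h2 : ∀ t ∈ Icc (0 : ℝ) 1, (Ω.toFun (c t) (-c' t : F) : F →L[ℝ] ℝ)
      = mfderiv J 𝓘(ℝ, ℝ) (fun x => f (γ t, x)) (c t)) :
    HamiltonianSegment (𝓘(ℝ, E →L[ℝ] ℝ).prod J)
      (naturalBracket I H Ω (fun _ _ _ => 0)) (γ 0, c 0) (γ 1, c 1) := by
  refine ⟨U, f, hamiltonianField I H Ω f, fun t => (γ t, c t), 0, 1, hU, hf,
    isHamiltonianVectorField_hamiltonianField I H Ω _ _, zero_le_one, hmem, fun t ht => ?_,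
    rfl, rfl⟩
  have hX : (hamiltonianField I H Ω f (γ t, c t) : (E →L[ℝ] ℝ) × F) = (γ' t, c' t) := by
    refine Prod.ext (h1 t ht) ?_
    exact (congrArg Neg.neg (Ω.sharp_eq (h2 t ht))).trans (neg_neg (c' t))
  have h3 : HasMFDerivWithinAt 𝓘(ℝ, ℝ) 𝓘(ℝ, E →L[ℝ] ℝ) γ (Icc 0 1) t
      ((1 : ℝ →L[ℝ] ℝ).smulRight (γ' t)) := (hγ t ht).hasFDerivWithinAt.hasMFDerivWithinAt
  have e : ((1 : ℝ →L[ℝ] ℝ).smulRight (γ' t)).prod ((1 : ℝ →L[ℝ] ℝ).smulRight (c' t))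
      = (1 : ℝ →L[ℝ] ℝ).smulRight
        (hamiltonianField I H Ω f (γ t, c t) : (E →L[ℝ] ℝ) × F) := by
    rw [hX]
    exact ContinuousLinearMap.ext fun _ => rfl
  exact (congrArg (fun T : ℝ →L[ℝ] (E →L[ℝ] ℝ) × F => HasMFDerivWithinAt 𝓘(ℝ, ℝ)
    (𝓘(ℝ, E →L[ℝ] ℝ).prod J) (fun t => (γ t, c t)) (Icc 0 1) t T) e).mp (h3.prodMk (hc t ht))

theorem hamiltonianSegment_coadjoint (Ω : SymplecticForm J P) {ξ : E} {γ : ℝ → E →L[ℝ] ℝ}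
    (hγ : ∀ t ∈ Icc (0 : ℝ) 1, HasDerivWithinAt γ ((γ t).comp (ad I H ξ)) (Icc 0 1) t) (x : P) :
    HamiltonianSegment (𝓘(ℝ, E →L[ℝ] ℝ).prod J)
      (naturalBracket I H Ω (fun _ _ _ => 0)) (γ 0, x) (γ 1, x) := by
  refine hamiltonianSegment_of_curve I H Ω (f := fun q => q.1 ξ) (c := fun _ => x)
    (c' := fun _ => 0) isOpen_univ
    ((ContinuousLinearMap.apply ℝ ℝ ξ).contMDiff.comp contMDiff_fst).contMDiffOn
    (fun _ _ => mem_univ _) hγ (fun t _ => ?_) (fun t _ => by rw [funcDeriv_apply])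
    (fun t _ => ?_)
  · have h0 : (1 : ℝ →L[ℝ] ℝ).smulRight (0 : F) = 0 := by ext; simp
    rw [h0]
    exact hasMFDerivWithinAt_const x (Icc 0 1) t
  · have h0 : (mfderiv J 𝓘(ℝ, ℝ) (fun _ : P => γ t ξ) x : F →L[ℝ] ℝ) = 0 := mfderiv_const
    refine Eq.trans ?_ h0.symm
    exact (congrArg (show F →L[ℝ] F →L[ℝ] ℝ from Ω.toFun x) neg_zero).trans (map_zero _)

theorem mfderiv_chart_symm_comp {y : P} {u : F} (hu : u ∈ (extChartAt J y).target) :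
    ContinuousLinearMap.comp (M₂ := F)
      (show F →L[ℝ] F from mfderiv 𝓘(ℝ, F) J (extChartAt J y).symm u)
      (show F →L[ℝ] F from mfderiv J 𝓘(ℝ, F) (extChartAt J y) ((extChartAt J y).symm u))
      = ContinuousLinearMap.id ℝ F := by
  have : IsManifold J 1 P := IsManifold.of_le (n := ∞) (by norm_cast)
  have h := mfderivWithin_extChartAt_symm_comp_mfderiv_extChartAt hu
  rw [ModelWithCorners.Boundaryless.range_eq_univ, mfderivWithin_univ] at h
  exact h

/-- The covector `-Ω(v, ·)`, in the coordinates of a chart. -/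
def chartCovector (Ω : SymplecticForm J P) (y : P) (v u : F) : F →L[ℝ] ℝ :=
  -((show F →L[ℝ] F →L[ℝ] ℝ from Ω.toFun ((extChartAt J y).symm u))
      (mfderiv 𝓘(ℝ, F) J (extChartAt J y).symm u v)).comp
    (show F →L[ℝ] F from mfderiv 𝓘(ℝ, F) J (extChartAt J y).symm u)

theorem contMDiffAt_chart_field {y : P} {u : F} (hu : u ∈ (extChartAt J y).target) (v : F) :
    ContMDiffAt 𝓘(ℝ, F) J.tangent ∞ (fun u => (Bundle.TotalSpace.mk' F ((extChartAt J y).symm u)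
      (mfderiv 𝓘(ℝ, F) J (extChartAt J y).symm u v) : TangentBundle J P)) u := by
  have : IsManifold J 1 P := IsManifold.of_le (n := ∞) (by norm_cast)
  have hT := isOpen_extChartAt_target (I := J) y
  have h1 := ((contMDiffOn_extChartAt_symm (I := J) (n := ∞) y).contMDiffOn_tangentMapWithin
    (m := ∞) (by simp) hT.uniqueMDiffOn)
  have h2 : ContMDiffAt 𝓘(ℝ, F) 𝓘(ℝ, F).tangent ∞
      (fun u : F => (Bundle.TotalSpace.mk' F u v : TangentBundle 𝓘(ℝ, F) F)) u :=
    contMDiffAt_vectorSpace_iff_contDiffAt.2 contDiffAt_const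
  have h3 := (ContMDiffWithinAt.comp u (h1 ⟨u, v⟩ hu) h2.contMDiffWithinAt
    (s := (extChartAt J y).target) fun w hw => hw).contMDiffAt (hT.mem_nhds hu)
  refine h3.congr_of_eventuallyEq (eventually_of_mem (hT.mem_nhds hu) fun w hw => ?_)
  simp only [Function.comp, tangentMapWithin, mfderivWithin_of_isOpen hT hw]

/-- The coefficients are the smooth form Ω evaluated on two coordinate vector fields of the chart.
-/
theorem contDiffOn_chartCovector (Ω : SymplecticForm J P) (y : P) (v : F) :
    ContDiffOn ℝ ∞ (chartCovector Ω y v) (extChartAt J y).target := by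
  rw [contDiffOn_clm_apply]
  refine fun w => ContDiffOn.neg fun u hu => ContDiffAt.contDiffWithinAt ?_
  have h : ContMDiffAt 𝓘(ℝ, F) (J.prod 𝓘(ℝ)) ∞ (fun u : F => Bundle.TotalSpace.mk' ℝ
      (E := Bundle.Trivial P ℝ) ((extChartAt J y).symm u) (Ω.toFun ((extChartAt J y).symm u)
        (mfderiv 𝓘(ℝ, F) J (extChartAt J y).symm u v)
        (mfderiv 𝓘(ℝ, F) J (extChartAt J y).symm u w))) u := by
    apply ContMDiffAt.clm_bundle_apply₂ (F₁ := F) (F₂ := F)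
    · exact Ω.smooth.contMDiffAt.comp u (contMDiffAt_extChartAt_symm hu)
    · exact contMDiffAt_chart_field hu v
    · exact contMDiffAt_chart_field hu w
  simp only [Bundle.contMDiffAt_totalSpace] at h
  exact h.2.contDiffAt

/-- If dh agrees with `chartCovector` at u, then -(d(h ∘ chart))^♯ is the coordinate vector v there:
the Hamiltonian velocity follows the line. -/
theorem apply_neg_eq_mfderiv (Ω : SymplecticForm J P) {y : P} {v u : F} {h : F → ℝ}
    (hu : u ∈ (extChartAt J y).target) (hh : HasFDerivAt h (chartCovector Ω y v u) u) :
    (Ω.toFun ((extChartAt J y).symm u)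
      (-(mfderiv 𝓘(ℝ, F) J (extChartAt J y).symm u v : F) : F) : F →L[ℝ] ℝ)
      = mfderiv J 𝓘(ℝ, ℝ) (fun x => h (extChartAt J y x)) ((extChartAt J y).symm u) := by
  have hs : (extChartAt J y).symm u ∈ (chartAt C y).source := by
    rw [← extChartAt_source J]; exact (extChartAt J y).map_target hu
  have : IsManifold J 1 P := IsManifold.of_le (n := ∞) (by norm_cast)
  have h1 : HasMFDerivAt 𝓘(ℝ, F) 𝓘(ℝ, ℝ) h
      (extChartAt J y ((extChartAt J y).symm u)) (chartCovector (F := F) Ω y v u) := by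
    have h0 : HasMFDerivAt 𝓘(ℝ, F) 𝓘(ℝ, ℝ) h u (chartCovector (F := F) Ω y v u) := hh.hasMFDerivAt
    rw [(extChartAt J y).right_inv hu]
    exact h0
  have h2 := h1.comp _ (mdifferentiableAt_extChartAt (I := J) hs).hasMFDerivAt
  refine Eq.trans ?_ h2.mfderiv.symm
  let D : F →L[ℝ] F := mfderiv 𝓘(ℝ, F) J (extChartAt J y).symm u
  let B : F →L[ℝ] F →L[ℝ] ℝ := Ω.toFun ((extChartAt J y).symm u)
  have h3 := congrArg (fun T : F →L[ℝ] F => (-(B (D v))).comp T) (mfderiv_chart_symm_comp hu)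
  have h4 : B (-D v) = (-(B (D v))).comp (ContinuousLinearMap.id ℝ F) := by
    rw [map_neg, ContinuousLinearMap.comp_id]
  exact h4.trans h3.symm

theorem hasMFDerivAt_chart_line {y : P} {u₀ v : F} {t : ℝ}
    (hu : u₀ + t • v ∈ (extChartAt J y).target) :
    HasMFDerivAt 𝓘(ℝ, ℝ) J (fun t : ℝ => (extChartAt J y).symm (u₀ + t • v)) t
      ((1 : ℝ →L[ℝ] ℝ).smulRight
        (mfderiv 𝓘(ℝ, F) J (extChartAt J y).symm (u₀ + t • v) v : F) : ℝ →L[ℝ] F) := by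
  have h1 : HasMFDerivAt 𝓘(ℝ, ℝ) 𝓘(ℝ, F) (fun t : ℝ => u₀ + t • v) t
      ((1 : ℝ →L[ℝ] ℝ).smulRight v) :=
    (((hasDerivAt_id t).smul_const v).const_add u₀ |>.congr_deriv
      (one_smul ℝ v)).hasFDerivAt.hasMFDerivAt
  have h2 := ((contMDiffAt_extChartAt_symm hu).mdifferentiableAt (by simp)).hasMFDerivAt.comp
    t h1
  let D : F →L[ℝ] F := mfderiv 𝓘(ℝ, F) J (extChartAt J y).symm (u₀ + t • v)
  have e : D.comp ((1 : ℝ →L[ℝ] ℝ).smulRight v) = (1 : ℝ →L[ℝ] ℝ).smulRight (D v) := by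
    ext; simp
  exact (congrArg (fun T : ℝ →L[ℝ] F => HasMFDerivAt 𝓘(ℝ, ℝ) J
    (fun t => (extChartAt J y).symm (u₀ + t • v)) t T) e).mp h2

/-- The covector -Ω(v, ·) annihilates v, so `exists_primitive_along_line` supplies a Hamiltonian
whose field has velocity v along the segment. -/
theorem hamiltonianSegment_chart (Ω : SymplecticForm J P) (μ : E →L[ℝ] ℝ) (y : P) {u₀ u₁ : F}
    (hseg : ∀ t ∈ Icc (0 : ℝ) 1, u₀ + t • (u₁ - u₀) ∈ (extChartAt J y).target) :
    HamiltonianSegment (𝓘(ℝ, E →L[ℝ] ℝ).prod J) (naturalBracket I H Ω (fun _ _ _ => 0))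
      (μ, (extChartAt J y).symm u₀) (μ, (extChartAt J y).symm u₁) := by
  set v := u₁ - u₀ with hv
  -- The primitive needs v ≠ 0. For v = 0 the curve is constant, the trajectory of the zero element
  -- of 𝔥.
  rcases eq_or_ne v 0 with h0 | h0
  · rw [sub_eq_zero.1 (hv.symm.trans h0)]
    refine hamiltonianSegment_coadjoint I H Ω (ξ := 0) (γ := fun _ => μ) (fun t _ => ?_) _
    simpa using hasDerivWithinAt_const t (Icc (0 : ℝ) 1) μ
  have hT := isOpen_extChartAt_target (I := J) y
  obtain ⟨U, h, hU, hh, hprim⟩ := exists_primitive_along_line hT (contDiffOn_chartCovector Ω y v)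
    h0 (fun u _ => by
      have := Ω.alternating _ (mfderiv 𝓘(ℝ, F) J (extChartAt J y).symm u v)
      exact (congrArg Neg.neg this).trans neg_zero) u₀
  have hopen : IsOpen ((extChartAt J y).source ∩ extChartAt J y ⁻¹' U) :=
    (continuousOn_extChartAt y).isOpen_inter_preimage (isOpen_extChartAt_source y) hU
  have hsm : ContMDiffOn J 𝓘(ℝ, ℝ) ∞ (fun x => h (extChartAt J y x))
      ((extChartAt J y).source ∩ extChartAt J y ⁻¹' U) :=
    hh.contMDiffOn.comp ((contMDiffOn_extChartAt (n := ∞)).mono fun x hx => by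
      rw [← extChartAt_source J]; exact hx.1) fun x hx => hx.2
  let c' : ℝ → F := fun t => mfderiv 𝓘(ℝ, F) J (extChartAt J y).symm (u₀ + t • v) v
  have hmem : ∀ t ∈ Icc (0 : ℝ) 1, (μ, (extChartAt J y).symm (u₀ + t • v)) ∈
      (univ : Set (E →L[ℝ] ℝ)) ×ˢ ((extChartAt J y).source ∩ extChartAt J y ⁻¹' U) := fun t ht =>
    ⟨mem_univ _, (extChartAt J y).map_target (hseg t ht), by
      rw [mem_preimage, (extChartAt J y).right_inv (hseg t ht)]
      exact (hprim t (hseg t ht)).1⟩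
  have hf : ContMDiffOn (𝓘(ℝ, E →L[ℝ] ℝ).prod J) 𝓘(ℝ, ℝ) ∞
      (fun q : (E →L[ℝ] ℝ) × P => h (extChartAt J y q.2))
      (univ ×ˢ ((extChartAt J y).source ∩ extChartAt J y ⁻¹' U)) :=
    hsm.comp contMDiffOn_snd fun q hq => hq.2
  have hconst : μ.comp (ad I H (0 : E)) = 0 := by simp
  have key := hamiltonianSegment_of_curve I H Ω (isOpen_univ.prod hopen) hf (γ := fun _ => μ)
    (c := fun t => (extChartAt J y).symm (u₀ + t • v)) (γ' := fun _ => 0) (c' := c') hmem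
    (fun t _ => hasDerivWithinAt_const t _ μ)
    (fun t ht => (hasMFDerivAt_chart_line (hseg t ht)).hasMFDerivWithinAt)
    (fun t _ => by
      rw [← hconst]
      exact congrArg (fun ζ => μ.comp (ad I H ζ)) (funcDeriv_const
        (h (extChartAt J y ((extChartAt J y).symm (u₀ + t • v)))) μ))
    (fun t ht => apply_neg_eq_mfderiv Ω (hseg t ht) (hprim t (hseg t ht)).2)
  beta_reduce at key
  rwa [zero_smul, add_zero, one_smul, hv, add_sub_cancel] at key

end Segments

/-! ### The symplectic leaves of the uncoupled bracket -/

section LeavesOfProduct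

variable {E : Type*} [NormedAddCommGroup E] [NormedSpace ℝ E] [FiniteDimensional ℝ E]
  {A : Type*} [TopologicalSpace A] (I : ModelWithCorners ℝ E A) [I.Boundaryless]
  (H : Type*) [TopologicalSpace H] [ChartedSpace A H] [Group H] [LieGroup I ∞ H]
  {F : Type*} [NormedAddCommGroup F] [NormedSpace ℝ F] [FiniteDimensional ℝ F]
  {C : Type*} [TopologicalSpace C] {J : ModelWithCorners ℝ F C} [J.Boundaryless]
  {P : Type*} [TopologicalSpace P] [ChartedSpace C P] [IsManifold J ∞ P]

/-- The neighbourhood corresponds to a ball inside the chart target; balls are convex, so chart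
segments between their points stay inside. -/
theorem eventually_hamiltonianSegment (Ω : SymplecticForm J P) (μ : E →L[ℝ] ℝ) (y : P) :
    ∃ N ∈ 𝓝 y, ∀ y₀ ∈ N, ∀ y₁ ∈ N, HamiltonianSegment (𝓘(ℝ, E →L[ℝ] ℝ).prod J)
      (naturalBracket I H Ω (fun _ _ _ => 0)) (μ, y₀) (μ, y₁) := by
  obtain ⟨ε, hε, hball⟩ := Metric.mem_nhds_iff.1 (extChartAt_target_mem_nhds (I := J) y)
  refine ⟨(extChartAt J y).source ∩ extChartAt J y ⁻¹' Metric.ball (extChartAt J y y) ε,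
    inter_mem (extChartAt_source_mem_nhds y)
      ((continuousAt_extChartAt y).preimage_mem_nhds (Metric.ball_mem_nhds _ hε)),
    fun y₀ h₀ y₁ h₁ => ?_⟩
  rw [← (extChartAt J y).left_inv h₀.1, ← (extChartAt J y).left_inv h₁.1]
  exact hamiltonianSegment_chart I H Ω μ y fun t ht =>
    hball ((convex_ball _ _).add_smul_sub_mem h₀.2 h₁.2 ht)

/-- On the neighbourhoods of `eventually_hamiltonianSegment` any two points are joined in either
order, so the reachable set is both open and closed. -/
theorem reflTransGen_snd [ConnectedSpace P] (Ω : SymplecticForm J P) (μ : E →L[ℝ] ℝ) (x y : P) :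
    Relation.ReflTransGen (HamiltonianSegment (𝓘(ℝ, E →L[ℝ] ℝ).prod J)
      (naturalBracket I H Ω (fun _ _ _ => 0))) (μ, x) (μ, y) := by
  let O : Set P := {y | Relation.ReflTransGen (HamiltonianSegment (𝓘(ℝ, E →L[ℝ] ℝ).prod J)
    (naturalBracket I H Ω (fun _ _ _ => 0))) (μ, x) (μ, y)}
  have hopen : IsOpen O := isOpen_iff_mem_nhds.2 fun z hz => by
    obtain ⟨N, hN, h⟩ := eventually_hamiltonianSegment I H Ω μ z
    exact mem_of_superset hN fun w hw => hz.tail (h z (mem_of_mem_nhds hN) w hw)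
  have hclosed : IsClosed O := isClosed_iff_frequently.2 fun z hz => by
    obtain ⟨N, hN, h⟩ := eventually_hamiltonianSegment I H Ω μ z
    obtain ⟨w, hw, hwN⟩ := (hz.and_eventually hN).exists
    exact Relation.ReflTransGen.tail hw (h w hwN z (mem_of_mem_nhds hN))
  have huniv : O = univ := IsClopen.eq_univ ⟨hclosed, hopen⟩ ⟨x, Relation.ReflTransGen.refl⟩
  exact (show y ∈ O by rw [huniv]; exact mem_univ y)

theorem symplecticLeaf_naturalBracket_zero [ConnectedSpace H] [ConnectedSpace P]
    (Ω : SymplecticForm J P) (μ : E →L[ℝ] ℝ) (x : P) :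
    symplecticLeaf (𝓘(ℝ, E →L[ℝ] ℝ).prod J) (naturalBracket I H Ω (fun _ _ _ => 0)) (μ, x)
      = coadjointOrbit I H μ ×ˢ univ := by
  apply Subset.antisymm
  · intro q hq
    refine ⟨?_, mem_univ _⟩
    induction hq with
    | refl => exact mem_coadjointOrbit_self I H μ
    | tail _ h ih =>
      exact coadjointOrbit_trans ih (HamiltonianSegment.fst_mem_coadjointOrbit I H h)
  · rintro ⟨ν, y⟩ ⟨hν, -⟩
    -- Move x to y with μ fixed, then μ to ν with y fixed.
    exact (reflTransGen_snd I H Ω μ x y).trans (coadjointOrbit_induction I H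
      (R := fun ν κ => Relation.ReflTransGen (HamiltonianSegment (𝓘(ℝ, E →L[ℝ] ℝ).prod J)
        (naturalBracket I H Ω (fun _ _ _ => 0))) (ν, y) (κ, y))
      (fun _ => Relation.ReflTransGen.refl) (fun _ _ _ h h' => h.trans h')
      (fun ξ γ hγ => Relation.ReflTransGen.single (hamiltonianSegment_coadjoint I H Ω hγ y)) hν)

theorem symplecticLeaves_naturalBracket_zero [ConnectedSpace H] [ConnectedSpace P]
    (Ω : SymplecticForm J P) :
    symplecticLeaves (𝓘(ℝ, E →L[ℝ] ℝ).prod J) (naturalBracket I H Ω (fun _ _ _ => 0))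
      = {L | ∃ μ : E →L[ℝ] ℝ, L = coadjointOrbit I H μ ×ˢ univ} := by
  ext L
  constructor
  · rintro ⟨⟨μ, x⟩, rfl⟩
    exact ⟨μ, symplecticLeaf_naturalBracket_zero I H Ω μ x⟩
  · rintro ⟨μ, rfl⟩
    obtain ⟨x⟩ := (inferInstance : Nonempty P)
    exact ⟨(μ, x), symplecticLeaf_naturalBracket_zero I H Ω μ x⟩

end LeavesOfProduct

/-! ### The coadjoint orbits of `SE(2)` -/

namespace SE2

/-- The rotational component of `e_Ω`. -/
def circleVec : EuclideanSpace ℝ (Fin 1) :=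
  mfderiv 𝓘(ℝ, ℝ) (𝓡 1) (fun t : ℝ => Circle.exp t) 0 (1 : ℝ)

theorem hasMFDerivAt_circleExp : HasMFDerivAt 𝓘(ℝ, ℝ) (𝓡 1) (fun t : ℝ => Circle.exp t) 0
    ((1 : ℝ →L[ℝ] ℝ).smulRight circleVec : ℝ →L[ℝ] EuclideanSpace ℝ (Fin 1)) := by
  have h : MDifferentiableAt 𝓘(ℝ, ℝ) (𝓡 1) (fun t : ℝ => Circle.exp t) 0 :=
    (contMDiff_circleExp (m := 1)).mdifferentiable (by simp) 0
  let T : ℝ →L[ℝ] EuclideanSpace ℝ (Fin 1) :=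
    mfderiv 𝓘(ℝ, ℝ) (𝓡 1) (fun t : ℝ => Circle.exp t) 0
  have e : T = (1 : ℝ →L[ℝ] ℝ).smulRight circleVec :=
    ContinuousLinearMap.ext_ring (one_smul ℝ (T 1)).symm
  exact (congrArg (fun T : ℝ →L[ℝ] EuclideanSpace ℝ (Fin 1) =>
    HasMFDerivAt 𝓘(ℝ, ℝ) (𝓡 1) (fun t : ℝ => Circle.exp t) 0 T) e).mp h.hasMFDerivAt

theorem hasDerivAt_exp_mul_I :
    HasDerivAt (fun t : ℝ => ((Circle.exp t : Circle) : ℂ)) Complex.I 0 := by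
  have h1 : HasDerivAt (fun t : ℝ => (t : ℂ) * Complex.I) Complex.I 0 := by
    simpa using (Complex.ofRealCLM.hasDerivAt (x := (0 : ℝ))).mul_const Complex.I
  simpa [Circle.coe_exp] using h1.cexp

/-- The chart of the circle leaves the coordinate of e_Ω implicit. It is nonzero because the
inclusion into ℂ sends this velocity to i. -/
theorem circleVec_ne_zero : circleVec ≠ 0 := by
  intro h
  have h1 := hasMFDerivAt_circleExp
  rw [h] at h1
  have h2 := ((contMDiff_coe.mdifferentiable (by simp) (Circle.exp 0)).hasMFDerivAt).comp
    (0 : ℝ) h1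
  let T : EuclideanSpace ℝ (Fin 1) →L[ℝ] ℂ :=
    mfderiv (𝓡 1) 𝓘(ℝ, ℂ) (fun z : Circle => (z : ℂ)) (Circle.exp 0)
  have h3 : HasFDerivAt (fun t : ℝ => ((Circle.exp t : Circle) : ℂ))
      (T.comp ((1 : ℝ →L[ℝ] ℝ).smulRight 0)) 0 := h2.hasFDerivAt
  have h4 := h3.hasDerivAt.unique hasDerivAt_exp_mul_I
  exact Complex.I_ne_zero (by simpa using h4.symm)

/-- The velocity of a curve in `SE(2)`, in terms of its components. -/
theorem hasMFDerivAt_curve {c : ℝ → Circle} {z : ℝ → ℂ} {c' : EuclideanSpace ℝ (Fin 1)} {z' : ℂ}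
    {t : ℝ} (hc : HasMFDerivAt 𝓘(ℝ, ℝ) (𝓡 1) c t
      ((1 : ℝ →L[ℝ] ℝ).smulRight c' : ℝ →L[ℝ] EuclideanSpace ℝ (Fin 1)))
    (hz : HasDerivAt z z' t) :
    HasMFDerivAt 𝓘(ℝ, ℝ) 𝓘SE (fun t => ((c t, z t) : SE2)) t
      ((1 : ℝ →L[ℝ] ℝ).smulRight ((c', z') : Model) : ℝ →L[ℝ] Model) := by
  have hz' : HasMFDerivAt 𝓘(ℝ, ℝ) 𝓘(ℝ, ℂ) z t ((1 : ℝ →L[ℝ] ℝ).smulRight z') :=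
    hz.hasFDerivAt.hasMFDerivAt
  have e : ((1 : ℝ →L[ℝ] ℝ).smulRight c').prod ((1 : ℝ →L[ℝ] ℝ).smulRight z')
      = (1 : ℝ →L[ℝ] ℝ).smulRight ((c', z') : Model) := ContinuousLinearMap.ext fun _ => rfl
  exact (congrArg (fun T : ℝ →L[ℝ] Model =>
    HasMFDerivAt 𝓘(ℝ, ℝ) 𝓘SE (fun t => ((c t, z t) : SE2)) t T) e).mp (hc.prodMk hz')

theorem hasMFDerivAt_translation (w : ℂ) :
    HasMFDerivAt 𝓘(ℝ, ℝ) 𝓘SE (fun t : ℝ => ((1, (t : ℂ) * w) : SE2)) 0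
      ((1 : ℝ →L[ℝ] ℝ).smulRight ((0, w) : Model) : ℝ →L[ℝ] Model) := by
  refine hasMFDerivAt_curve (c := fun _ => 1) ?_ ?_
  · have e : (0 : ℝ →L[ℝ] EuclideanSpace ℝ (Fin 1)) = (1 : ℝ →L[ℝ] ℝ).smulRight 0 := by ext; simp
    exact (congrArg (fun T : ℝ →L[ℝ] EuclideanSpace ℝ (Fin 1) =>
      HasMFDerivAt 𝓘(ℝ, ℝ) (𝓡 1) (fun _ : ℝ => (1 : Circle)) 0 T) e).mp
      (hasMFDerivAt_const (1 : Circle) (0 : ℝ))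
  · simpa using (Complex.ofRealCLM.hasDerivAt (x := (0 : ℝ))).mul_const w

theorem hasMFDerivAt_rotation {z : ℝ → ℂ} {z' : ℂ} (hz : HasDerivAt z z' 0) :
    HasMFDerivAt 𝓘(ℝ, ℝ) 𝓘SE (fun t : ℝ => ((Circle.exp t, z t) : SE2)) 0
      ((1 : ℝ →L[ℝ] ℝ).smulRight ((circleVec, z') : Model) : ℝ →L[ℝ] Model) :=
  hasMFDerivAt_curve hasMFDerivAt_circleExp hz

theorem ex_eq : ex = (0, 1) := by
  have h := hasMFDerivAt_translation 1
  have e : (fun t : ℝ => ((1, (t : ℂ) * 1) : SE2)) = fun t : ℝ => ((1, (t : ℂ)) : SE2) := by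
    funext t; rw [mul_one]
  rw [e] at h
  exact (congrArg (fun T : ℝ →L[ℝ] Model => T 1) h.mfderiv).trans (one_smul ℝ _)

theorem ey_eq : ey = (0, Complex.I) :=
  (congrArg (fun T : ℝ →L[ℝ] Model => T 1) (hasMFDerivAt_translation Complex.I).mfderiv).trans
    (one_smul ℝ _)

theorem eΩ_eq : eΩ = (circleVec, 0) :=
  (congrArg (fun T : ℝ →L[ℝ] Model => T 1)
    (hasMFDerivAt_rotation (hasDerivAt_const (0 : ℝ) (0 : ℂ))).mfderiv).trans (one_smul ℝ _)

/-- Computes Ad_g on the velocity of a curve through 1 as the velocity of the conjugated curve, so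
that the charts of SE(2) need no unfolding. -/
theorem Ad_curve (g : SE2) {γ : ℝ → SE2} {γ' δ' : Model} (h0 : γ 0 = 1)
    (hγ : HasMFDerivAt 𝓘(ℝ, ℝ) 𝓘SE γ 0 ((1 : ℝ →L[ℝ] ℝ).smulRight γ' : ℝ →L[ℝ] Model))
    (hδ : HasMFDerivAt 𝓘(ℝ, ℝ) 𝓘SE (fun t => g * γ t * g⁻¹) 0
      ((1 : ℝ →L[ℝ] ℝ).smulRight δ' : ℝ →L[ℝ] Model)) :
    Ad 𝓘SE g γ' = δ' := by
  have h1 : HasMFDerivAt 𝓘SE 𝓘SE (fun h : SE2 => g * h * g⁻¹) (γ 0) (Ad 𝓘SE g) := by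
    rw [h0]
    exact (mdifferentiable_conj 𝓘SE SE2 g 1).hasMFDerivAt
  have h2 := hasMFDerivAt_unique (h1.comp (0 : ℝ) hγ) hδ
  have h3 := congrArg (fun T : ℝ →L[ℝ] Model => T 1) h2
  exact ((congrArg (Ad 𝓘SE g) (one_smul ℝ γ')).symm.trans h3).trans (one_smul ℝ δ')

theorem conj_eq (g h : SE2) : g * h * g⁻¹
    = ((h.1, (g.1 : ℂ) * h.2 + (1 - (h.1 : ℂ)) * g.2) : SE2) := by
  refine Prod.ext (mul_inv_cancel_comm g.1 h.1) ?_
  change ((g.1 * h.1 : Circle) : ℂ) * (-(((g.1⁻¹ : Circle) : ℂ) * g.2)) + (g.1 * h.2 + g.2) = _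
  have : ((g.1 : Circle) : ℂ) ≠ 0 := Circle.coe_ne_zero g.1
  push_cast
  field_simp
  ring

theorem Ad_translation (g : SE2) (w : ℂ) :
    Ad 𝓘SE g ((0, w) : Model) = (0, (g.1 : ℂ) * w) := by
  let γ : ℝ → SE2 := fun t => (1, (t : ℂ) * w)
  refine Ad_curve g (γ := γ) (Prod.ext rfl (by simp [γ]; rfl)) (hasMFDerivAt_translation w) ?_
  have e : (fun t : ℝ => g * γ t * g⁻¹)
      = fun t : ℝ => ((1, (t : ℂ) * ((g.1 : ℂ) * w)) : SE2) := by
    funext t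
    rw [conj_eq]
    exact Prod.ext rfl (by simp [γ]; ring)
  rw [e]
  exact hasMFDerivAt_translation _

theorem Ad_rotation (g : SE2) :
    Ad 𝓘SE g eΩ = (circleVec, -(Complex.I * g.2)) := by
  rw [eΩ_eq]
  let γ : ℝ → SE2 := fun t => (Circle.exp t, 0)
  refine Ad_curve g (γ := γ) (Prod.ext (by simp [γ]; rfl) rfl)
    (hasMFDerivAt_rotation (hasDerivAt_const (0 : ℝ) (0 : ℂ))) ?_
  have e : (fun t : ℝ => g * γ t * g⁻¹)
      = fun t : ℝ => ((Circle.exp t, (1 - ((Circle.exp t : Circle) : ℂ)) * g.2) : SE2) := by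
    funext t
    rw [conj_eq]
    exact Prod.ext rfl (by simp [γ])
  rw [e]
  exact hasMFDerivAt_rotation (by simpa using (hasDerivAt_exp_mul_I.const_sub 1).mul_const g.2)

theorem Ad_ex (g : SE2) : Ad 𝓘SE g ex = (g.1 : ℂ).re • ex + (g.1 : ℂ).im • ey := by
  rw [ex_eq, ey_eq, Ad_translation]
  refine Prod.ext (by simp) (Complex.ext ?_ ?_) <;> simp

theorem Ad_ey (g : SE2) : Ad 𝓘SE g ey = -(g.1 : ℂ).im • ex + (g.1 : ℂ).re • ey := by
  rw [ex_eq, ey_eq, Ad_translation]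
  refine Prod.ext (by simp) (Complex.ext ?_ ?_) <;> simp

theorem Ad_eΩ (g : SE2) : Ad 𝓘SE g eΩ = eΩ + g.2.im • ex - g.2.re • ey := by
  rw [Ad_rotation, ex_eq, ey_eq, eΩ_eq]
  refine Prod.ext (by simp) (Complex.ext ?_ ?_) <;> simp

theorem eq_smul_add_smul_add_smul (v : Model) :
    v = (v.1 0 / circleVec 0) • eΩ + v.2.re • ex + v.2.im • ey := by
  have h : circleVec 0 ≠ 0 := fun h =>
    circleVec_ne_zero (by ext i; rw [Subsingleton.elim i 0, h]; rfl)
  rw [ex_eq, ey_eq, eΩ_eq]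
  refine Prod.ext ?_ (Complex.ext ?_ ?_)
  · ext i
    rw [Subsingleton.elim i 0]
    simp [h]
  · simp
  · simp

theorem dual_ext {μ ν : Model →L[ℝ] ℝ} (hx : μ ex = ν ex) (hy : μ ey = ν ey)
    (hΩ : μ eΩ = ν eΩ) : μ = ν := by
  refine ContinuousLinearMap.ext fun v => ?_
  rw [eq_smul_add_smul_add_smul v]
  simp only [map_add, map_smul, hx, hy, hΩ]

/-- The covector with coordinates `(Π_x, 0, Π_Ω) = (a, 0, c)`. -/
def covector (a c : ℝ) : Model →L[ℝ] ℝ :=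
  a • Complex.reCLM.comp (ContinuousLinearMap.snd ℝ (EuclideanSpace ℝ (Fin 1)) ℂ)
    + (c / circleVec 0) • (EuclideanSpace.proj (0 : Fin 1)).comp
      (ContinuousLinearMap.fst ℝ (EuclideanSpace ℝ (Fin 1)) ℂ)

theorem covector_apply (a c : ℝ) :
    covector a c ex = a ∧ covector a c ey = 0 ∧ covector a c eΩ = c := by
  have h : circleVec 0 ≠ 0 := fun h =>
    circleVec_ne_zero (by ext i; rw [Subsingleton.elim i 0, h]; rfl)
  rw [ex_eq, ey_eq, eΩ_eq]
  simp [covector, h]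

theorem comp_Ad_apply (μ : Model →L[ℝ] ℝ) (g : SE2) :
    μ.comp (Ad 𝓘SE g) ex = (g.1 : ℂ).re * μ ex + (g.1 : ℂ).im * μ ey ∧
    μ.comp (Ad 𝓘SE g) ey = -(g.1 : ℂ).im * μ ex + (g.1 : ℂ).re * μ ey ∧
    μ.comp (Ad 𝓘SE g) eΩ = μ eΩ + g.2.im * μ ex - g.2.re * μ ey := by
  simp only [ContinuousLinearMap.comp_apply, Ad_ex, Ad_ey, Ad_eΩ, map_add, map_sub, map_smul,
    smul_eq_mul, and_self]

theorem re_sq_add_im_sq (z : Circle) : (z : ℂ).re ^ 2 + (z : ℂ).im ^ 2 = 1 := by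
  have h := Circle.normSq_coe z
  rw [Complex.normSq_apply] at h
  linarith

/-- The rotation reaches every angle of (Π_x, Π_y), and the translation then reaches every value of
Π_Ω since (Π_x, Π_y) ≠ 0. -/
theorem coadjointOrbit_eq_cylinder {μ : Model →L[ℝ] ℝ} (h : 0 < μ ex ^ 2 + μ ey ^ 2) :
    coadjointOrbit 𝓘SE SE2 μ = cylinder (μ ex ^ 2 + μ ey ^ 2) := by
  ext ν
  constructor
  · rintro ⟨g, rfl⟩
    obtain ⟨h1, h2, -⟩ := comp_Ad_apply μ g⁻¹
    have h3 := re_sq_add_im_sq (g⁻¹).1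
    change μ.comp (Ad 𝓘SE g⁻¹) ex ^ 2 + μ.comp (Ad 𝓘SE g⁻¹) ey ^ 2 = _
    rw [h1, h2]
    linear_combination (μ ex ^ 2 + μ ey ^ 2) * h3
  · intro hν
    have hν' : ν ex ^ 2 + ν ey ^ 2 = μ ex ^ 2 + μ ey ^ 2 := hν
    set r := μ ex ^ 2 + μ ey ^ 2 with hr
    -- Writing p = μ_x + iμ_y and q = ν_x + iν_y, the action is q = z̄ p, whence z = q̄ p / |p|².
    let z : ℂ := ⟨(ν ex * μ ex + ν ey * μ ey) / r, (ν ex * μ ey - ν ey * μ ex) / r⟩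
    have hz : z ∈ Submonoid.unitSphere ℂ := by
      refine mem_sphere_zero_iff_norm.2 ((sq_eq_sq₀ (norm_nonneg z) zero_le_one).1 ?_)
      rw [Complex.sq_norm, Complex.normSq_apply]
      change (ν ex * μ ex + ν ey * μ ey) / r * ((ν ex * μ ex + ν ey * μ ey) / r)
        + (ν ex * μ ey - ν ey * μ ex) / r * ((ν ex * μ ey - ν ey * μ ex) / r) = 1 ^ 2
      field_simp
      linear_combination (μ ex ^ 2 + μ ey ^ 2) * hν' - (r + μ ex ^ 2 + μ ey ^ 2) * hr
    -- Solves w.im * μ_x - w.re * μ_y = ν_Ω - μ_Ω by the multiple of (-μ_y, μ_x) with the right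
    -- length.
    let w : ℂ := ⟨-((ν eΩ - μ eΩ) * μ ey / r), (ν eΩ - μ eΩ) * μ ex / r⟩
    let g : SE2 := ((⟨z, hz⟩ : Circle), w)
    have e : ν = μ.comp (Ad 𝓘SE g) := by
      obtain ⟨h1, h2, h3⟩ := comp_Ad_apply μ g
      refine dual_ext ?_ ?_ ?_
      · rw [h1]
        change ν ex = (ν ex * μ ex + ν ey * μ ey) / r * μ ex
          + (ν ex * μ ey - ν ey * μ ex) / r * μ ey
        field_simp
        rw [hr]; ring
      · rw [h2]
        change ν ey = -((ν ex * μ ey - ν ey * μ ex) / r) * μ ex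
          + (ν ex * μ ex + ν ey * μ ey) / r * μ ey
        field_simp
        rw [hr]; ring
      · rw [h3]
        change ν eΩ = μ eΩ + (ν eΩ - μ eΩ) * μ ex / r * μ ex
          - -((ν eΩ - μ eΩ) * μ ey / r) * μ ey
        field_simp
        rw [hr]; ring
    rw [e]
    exact comp_Ad_mem_coadjointOrbit 𝓘SE μ g

theorem coadjointOrbit_eq_axisPoint {μ : Model →L[ℝ] ℝ} (hx : μ ex = 0) (hy : μ ey = 0) :
    coadjointOrbit 𝓘SE SE2 μ = axisPoint (μ eΩ) := by
  ext ν
  constructor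
  · rintro ⟨g, rfl⟩
    obtain ⟨h1, h2, h3⟩ := comp_Ad_apply μ g⁻¹
    refine ⟨?_, ?_, ?_⟩
    · rw [h1, hx, hy]; ring
    · rw [h2, hx, hy]; ring
    · rw [h3, hx, hy]; ring
  · rintro ⟨h1, h2, h3⟩
    rw [dual_ext (h1.trans hx.symm) (h2.trans hy.symm) h3]
    exact mem_coadjointOrbit_self 𝓘SE SE2 μ

theorem exists_coadjointOrbit_eq_iff (O : Set (Model →L[ℝ] ℝ)) :
    (∃ μ, O = coadjointOrbit 𝓘SE SE2 μ) ↔ (∃ r > 0, O = cylinder r) ∨ ∃ c, O = axisPoint c := by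
  constructor
  · rintro ⟨μ, rfl⟩
    rcases (by positivity : 0 ≤ μ ex ^ 2 + μ ey ^ 2).lt_or_eq with h | h
    · exact Or.inl ⟨_, h, coadjointOrbit_eq_cylinder h⟩
    · have hx : μ ex = 0 := by nlinarith [sq_nonneg (μ ex), sq_nonneg (μ ey)]
      have hy : μ ey = 0 := by nlinarith [sq_nonneg (μ ex), sq_nonneg (μ ey)]
      exact Or.inr ⟨_, coadjointOrbit_eq_axisPoint hx hy⟩
  · rintro (⟨r, hr, rfl⟩ | ⟨c, rfl⟩)
    -- The constant r of `cylinder` is the square of the radius, so (√r, 0, 0) lies on it.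
    · obtain ⟨h1, h2, -⟩ := covector_apply (√r) 0
      have h : covector (√r) 0 ex ^ 2 + covector (√r) 0 ey ^ 2 = r := by
        rw [h1, h2, Real.sq_sqrt hr.le]; ring
      exact ⟨covector (√r) 0, by rw [coadjointOrbit_eq_cylinder (by rw [h]; exact hr), h]⟩
    · obtain ⟨h1, h2, h3⟩ := covector_apply 0 c
      exact ⟨covector 0 c, by rw [coadjointOrbit_eq_axisPoint h1 h2, h3]⟩

instance : ConnectedSpace SE2 := inferInstanceAs (ConnectedSpace (Circle × ℂ))

end SE2

end SymplecticLeaves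

end

/-! ### Assembly: general leaves, the orbits of SE(2), point vortices -/

theorem mainTheorem8 :
    -- the general case
    (∀ (E : Type*) [NormedAddCommGroup E] [NormedSpace ℝ E] [FiniteDimensional ℝ E]
      (A : Type*) [TopologicalSpace A] (I : ModelWithCorners ℝ E A) [I.Boundaryless]
      (H : Type*) [TopologicalSpace H] [ChartedSpace A H] [Group H] [LieGroup I ∞ H]
      [T2Space H] [SecondCountableTopology H] [ConnectedSpace H]
      (F : Type*) [NormedAddCommGroup F] [NormedSpace ℝ F] [FiniteDimensional ℝ F]
      (C : Type*) [TopologicalSpace C] (J : ModelWithCorners ℝ F C) [J.Boundaryless]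
      (P : Type*) [TopologicalSpace P] [ChartedSpace C P] [IsManifold J ∞ P]
      [T2Space P] [SecondCountableTopology P] [ConnectedSpace P]
      [MulAction H P] [ContMDiffSMul I J ∞ H P]
      (Ω : SymplecticLeaves.SymplecticForm J P)
      (D : SymplecticLeaves.MagneticCoupling (I := I) H Ω),
      (∀ (ξ η : E) (p : H × P), D.cocycle ξ η p = 0) →
      (∀ (μ : E →L[ℝ] ℝ) (x : P),
        SymplecticLeaves.symplecticLeaf (𝓘(ℝ, E →L[ℝ] ℝ).prod J)
          (SymplecticLeaves.naturalBracket I H Ω D.cocycle) (μ, x)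
          = SymplecticLeaves.coadjointOrbit I H μ ×ˢ univ) ∧
      SymplecticLeaves.symplecticLeaves (𝓘(ℝ, E →L[ℝ] ℝ).prod J)
          (SymplecticLeaves.naturalBracket I H Ω D.cocycle)
        = {L | ∃ μ : E →L[ℝ] ℝ, L = SymplecticLeaves.coadjointOrbit I H μ ×ˢ univ}) ∧
    -- the coadjoint orbits of `SE(2)`
    range (SymplecticLeaves.coadjointOrbit SymplecticLeaves.SE2.𝓘SE SymplecticLeaves.SE2)
      = {O | ∃ r > 0, O = SymplecticLeaves.SE2.cylinder r} ∪
        {O | ∃ c, O = SymplecticLeaves.SE2.axisPoint c} ∧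
    -- the symplectic leaves for `SE(2)` and `ℝ^{2N}`
    (∀ (N : ℕ) (Γ : Fin N → ℝ) (hΓ : ∀ i, Γ i ≠ 0),
      SymplecticLeaves.symplecticLeaves
          (𝓘(ℝ, SymplecticLeaves.SE2.Model →L[ℝ] ℝ).prod 𝓘(ℝ, Fin N → ℂ))
          (SymplecticLeaves.naturalBracket SymplecticLeaves.SE2.𝓘SE SymplecticLeaves.SE2
            (SymplecticLeaves.vortexForm Γ hΓ) (fun _ _ _ => 0))
        = {L | ∃ r > 0, L = SymplecticLeaves.SE2.cylinder r ×ˢ univ} ∪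
          {L | ∃ c, L = SymplecticLeaves.SE2.axisPoint c ×ˢ univ}) := by
  refine ⟨?_, ?_, ?_⟩
  · intro E _ _ _ A _ I _ H _ _ _ _ _ _ _ F _ _ _ C _ J _ P _ _ _ _ _ _ _ _ Ω D hD
    have h : D.cocycle = fun _ _ _ => 0 := by
      funext ξ η p
      exact hD ξ η p
    rw [h]
    exact ⟨SymplecticLeaves.symplecticLeaf_naturalBracket_zero I H Ω,
      SymplecticLeaves.symplecticLeaves_naturalBracket_zero I H Ω⟩
  · ext O
    simpa only [mem_range, eq_comm, mem_union, mem_ofPred_eq] using!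
      SymplecticLeaves.SE2.exists_coadjointOrbit_eq_iff O
  · intro N Γ hΓ
    rw [SymplecticLeaves.symplecticLeaves_naturalBracket_zero]
    ext L
    constructor
    · rintro ⟨μ, rfl⟩
      rcases (SymplecticLeaves.SE2.exists_coadjointOrbit_eq_iff _).1 ⟨μ, rfl⟩ with
        ⟨r, hr, h⟩ | ⟨c, h⟩
      · exact Or.inl ⟨r, hr, by rw [h]⟩
      · exact Or.inr ⟨c, by rw [h]⟩
    · rintro (⟨r, hr, rfl⟩ | ⟨c, rfl⟩)
      · obtain ⟨μ, h⟩ := (SymplecticLeaves.SE2.exists_coadjointOrbit_eq_iff _).2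
          (Or.inl ⟨r, hr, rfl⟩)
        exact ⟨μ, by rw [h]⟩
      · obtain ⟨μ, h⟩ := (SymplecticLeaves.SE2.exists_coadjointOrbit_eq_iff _).2
          (Or.inr ⟨c, rfl⟩)
        exact ⟨μ, by rw [h]⟩
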